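/- **Setting.** Let $D$ be a probability distribution on a data space $\mathcal Z$, $f:\mathbb R^d\times\mathcal Z\to\mathbb R$ a cost with $F(x)=\mathbb E_{z\sim D}[f(x,z)]$ finite for all $x$, and $\mathcal X\subset\mathbb R^d$ convex and compact with diameter $R>0$. Let $\mu,L,\sigma>0$, $a\ge 0$ and $\kappa=L/\mu$. Assume that on $\mathcal X$ the function $F$ is differentiable with $\langle\nabla F(x)-\nabla F(y),x-y\rangle\ge\mu\|x-y\|^2$, that for every $z$ the function $f(\cdot,z)$ is differentiable with $L$-Lipschitz gradient, and that for all $x\in\mathcal X$ and all coordinates $k$ the noise $\xi=\partial_kf(x,z)-\partial_kF(x)$ is sub-gamma: $\log\mathbb E_{z\sim D}[e^{\lambda\xi}]\le\frac{\lambda^2\sigma^2}{2(1-a|\lambda|)}$ whenever $a|\lambda|<1$. Assume that $F$ has a unique minimizer $x^\star$ in $\mathcal X$ and that $\nabla F(x^\star)=0$. **Agents.** There are $N\ge1$ agents. Agent $i$ holds $b\ge1$ data points $z_i^1,\dots,z_i^b$, all $Nb$ of them drawn once, independently, from $D$ (the SAA setting), and $F_i(x)=\frac1b\sum_jf(x,z_i^j)$.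 At each iteration $t\ge1$ an agent is trustworthy ($W_{i,t}=0$) or Byzantine ($W_{i,t}=1$). The agents' states are independent two-state Markov chains with arbitrary initial states and with transition probabilities $p_b$ (trustworthy to Byzantine) and $p_t$ (Byzantine to trustworthy), $0<p_b<p_t<1$; given all information available up to iteration $t$ (which includes the iterate $x_t$), the states at iteration $t+1$ depend only on those at iteration $t$. **Algorithm (RANGE).** Let $m\ge1$, $m_0\ge0$, $T\ge1$ be integers, $\gamma>0$, $x_1\in\mathcal X$, and $\alpha_1,\alpha_2<\frac12$ with $\alpha_1m,\alpha_2N\in\mathbb N_0$. A robust mean with parameter $\alpha$ of $k$ vectors is, in each coordinate, the average of the $(1-\alpha)k$ values nearest to the median of that coordinate (ties broken arbitrarily). At iterations $t=1,\dots,T+m-1+m_0$, agent $i$ sends $g_{i,t}=\nabla F_i(x_t)$ if it is trustworthy and an arbitrary vector $g_{i,t}$ if it is Byzantine. Put $\hat g_{i,t}=g_{i,t}$ if $t<m$, and let $\hat g_{i,t}$ be a robust mean with parameter $\alpha_1$ of $g_{i,t},g_{i,t-1},\dots,g_{i,t-m+1}$ if $t\ge m$. Let $\hat{\hat g}_t$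 be a robust mean with parameter $\alpha_2$ of $\hat g_{1,t},\dots,\hat g_{N,t}$, and let $x_{t+1}$ be the projection of $x_t-\gamma\,\hat{\hat g}_t/\|\hat{\hat g}_t\|$ on $\mathcal X$ (with $0/\|0\|=0$). **Failure probability.** Let $Z_t=1$ if more than $\alpha_2N$ of the agents satisfy $\sum_{\tau=t-m+1}^tW_{i,\tau}>\alpha_1m$, and $Z_t=0$ otherwise. Let $P=P_Z^m(m_0)$ be any upper bound, uniform over the configurations of all agents at time $t-m+1-m_0$, on the conditional probability of $Z_t=1$ given that configuration (for instance the largest of these probabilities; they depend only on $m_0,m,N,\alpha_1,\alpha_2,p_b,p_t$). **Constants.** Let $$C_\alpha=\frac{2\alpha}{1-\alpha}\Big(1+\sqrt{\tfrac{(1-\alpha)^2}{1-2\alpha}}\Big)\sqrt d,\qquad c_0=\frac{2}{\kappa R}\big(1-P(1+\kappa)\big),$$ $$\overline C=1+4P\big(1+\tfrac1\kappa\big)(m-1+m_0)+4\kappa(m-1)\big(1+C_{\alpha_1}+2C_{\alpha_2}(C_{\alpha_1}+1)\big).$$ **Theorem 1.** There is a constant $C>0$, depending only on $d,\mu,L,R,\sigma,a$,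 such that in every such setting, if $$P<\frac1{1+\kappa},\qquad \gamma\le\frac{4\sigma}{\overline C\mu\sqrt{(1-\alpha_2)Nb}}\qquad\text{and}\qquad c_0\gamma\le1,$$ then $$\mathbb E\|x_{T+m+m_0}-x^\star\|^2\le\big(\|x_1-x^\star\|+\gamma(m+m_0-1)\big)^2(1-c_0\gamma)^T+\frac{C}{1-P(1+\kappa)}\left(\frac1{\sqrt{Nb}}+C_{\alpha_2}\Big(\frac{\sqrt{\Lambda}}{\sqrt b}+\frac{\Lambda}{b}\Big)\right),$$ where $\Lambda=\log(2(1-\alpha_2)Nd)$. Up to the logarithmic factor, the last term is $O\big(\frac1{\sqrt{Nb}}+\frac{C_{\alpha_2}}{\sqrt b}\big)$: RANGE converges linearly to a neighborhood of $x^\star$. -/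

import Mathlib

open MeasureTheory ProbabilityTheory

namespace RangeSAA

noncomputable section

/-- `ℝ^d` with the Euclidean norm. -/
abbrev Vec (d : ℕ) : Type := EuclideanSpace ℝ (Fin d)

/-! ### The optimization problem -/

/-- The expected cost `F(x) = E_{z ∼ D} f(x, z)`. -/
def expectedCost {d : ℕ} {Z : Type*} [MeasurableSpace Z] (D : Measure Z)
    (f : Vec d → Z → ℝ) (x : Vec d) : ℝ :=
  ∫ z, f x z ∂D

/-- The empirical risk `(1/b) ∑_j f(x, z_j)` of a batch of `b` data points. -/
def empiricalRisk {d b : ℕ} {Z : Type*} (f : Vec d → Z → ℝ) (zs : Fin b → Z) (x : Vec d) : ℝ :=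
  (1 / (b : ℝ)) * ∑ j, f x (zs j)

/-- `h` is differentiable at the points of `X`, with `L`-Lipschitz gradient on `X`. -/
def IsSmoothOn {d : ℕ} (L : ℝ) (X : Set (Vec d)) (h : Vec d → ℝ) : Prop :=
  (∀ x ∈ X, DifferentiableAt ℝ h x) ∧
    ∀ x ∈ X, ∀ y ∈ X, ‖gradient h x - gradient h y‖ ≤ L * ‖x - y‖

/-- `h` is differentiable at the points of `X`, with `μ`-strongly monotone gradient on `X`. -/
def IsStronglyConvexOn {d : ℕ} (μ : ℝ) (X : Set (Vec d)) (h : Vec d → ℝ) : Prop :=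
  (∀ x ∈ X, DifferentiableAt ℝ h x) ∧
    ∀ x ∈ X, ∀ y ∈ X,
      μ * ‖x - y‖ ^ 2 ≤ inner ℝ (gradient h x - gradient h y) (x - y)

/-- Every coordinate `∂_k f(x, z) - ∂_k F(x)` of the gradient noise at a point of `X` is sub-gamma
with variance factor `σ` and scale `a` (no restriction on `l` when `a = 0`). The exponential
moments are required to exist. -/
def HasSubGammaNoise {d : ℕ} {Z : Type*} [MeasurableSpace Z] (D : Measure Z)
    (f : Vec d → Z → ℝ) (X : Set (Vec d)) (σ a : ℝ) : Prop :=
  ∀ x ∈ X, ∀ k : Fin d, ∀ l : ℝ, a * |l| < 1 →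
    Integrable (fun z => Real.exp
      (l * (gradient (fun y => f y z) x k - gradient (expectedCost D f) x k))) D ∧
    Real.log (∫ z, Real.exp
      (l * (gradient (fun y => f y z) x k - gradient (expectedCost D f) x k)) ∂D)
      ≤ l ^ 2 * σ ^ 2 / (2 * (1 - a * |l|))

/-! ### The agents' states: `0` is trustworthy, `1` is Byzantine -/

/-- The states of all `N` agents at one iteration. -/
abbrev Config (N : ℕ) : Type := Fin N → Fin 2

/-- The transition matrix of a single agent. -/
def transitionMatrix (pb pt : ℝ) : Matrix (Fin 2) (Fin 2) ℝ :=
  !![1 - pb, pb; pt, 1 - pt]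

/-- The probability that the `N` agents, moving independently, go from `w` to `w'`. -/
def jointTransition {N : ℕ} (pb pt : ℝ) (w w' : Config N) : ℝ :=
  ∏ i, transitionMatrix pb pt (w i) (w' i)

/-- From iteration `1` on, the agents' states form independent two-state Markov chains, relative
to the filtration `ℱ` (the information available up to each iteration). The initial states are
arbitrary. -/
def IsAgentChain {N : ℕ} {Ω : Type*} {mΩ : MeasurableSpace Ω} (Pr : Measure Ω)
    (ℱ : Filtration ℕ mΩ) (pb pt : ℝ) (W : ℕ → Ω → Config N) : Prop :=
  Adapted ℱ W ∧
    ∀ t, 1 ≤ t → ∀ w : Config N,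
      Pr[Set.indicator {ω | W (t + 1) ω = w} (fun _ => (1 : ℝ)) | ℱ t]
        =ᵐ[Pr] fun ω => jointTransition pb pt (W t ω) w

open Classical in
/-- The event `Z_t = 1` for the window `v` of the last `m` configurations: more than `α₂ N` agents
were Byzantine more than `α₁ m` times. -/
def WindowFails {N m : ℕ} (α₁ α₂ : ℝ) (v : Fin m → Config N) : Prop :=
  α₂ * N < ((Finset.univ.filter
    (fun i : Fin N => α₁ * m < ((∑ τ, (v τ i : ℕ) : ℕ) : ℝ))).card : ℝ)

open Classical in
/-- The probability that `n` consecutive configurations of the chain, the first of which is `w₀`,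
are `p`. -/
def pathProb {N n : ℕ} (pb pt : ℝ) (w₀ : Config N) (p : Fin n → Config N) : ℝ :=
  (if ∀ h : 0 < n, p ⟨0, h⟩ = w₀ then 1 else 0) *
    ∏ k : Fin n, if h : (k : ℕ) + 1 < n then jointTransition pb pt (p k) (p ⟨k + 1, h⟩) else 1

open Classical in
/-- The probability of `Z_t = 1` given that the configuration at iteration `t - m + 1 - m₀` is
`w₀`. -/
def failureProbFrom (m₀ m N : ℕ) (α₁ α₂ pb pt : ℝ) (w₀ : Config N) : ℝ :=
  ∑ p : Fin (m₀ + m) → Config N,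
    pathProb pb pt w₀ p *
      (if WindowFails α₁ α₂ (fun τ : Fin m => p (Fin.natAdd m₀ τ)) then 1 else 0)

/-- The least bound on the probability of `Z_t = 1` given the past up to iteration
`t - m + 1 - m₀` that is uniform in that past. -/
def failureProb (m₀ m N : ℕ) (α₁ α₂ pb pt : ℝ) : ℝ :=
  ⨆ w₀ : Config N, failureProbFrom m₀ m N α₁ α₂ pb pt w₀

/-! ### The algorithm -/

/-- `c` is a median of `v₀, …, v_{k-1}`: at least half of the values are `≤ c`, and at least half
are `≥ c`. -/
def IsMedian {k : ℕ} (v : Fin k → ℝ) (c : ℝ) : Prop :=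
  k ≤ 2 * (Finset.univ.filter (fun i => v i ≤ c)).card ∧
    k ≤ 2 * (Finset.univ.filter (fun i => c ≤ v i)).card

/-- `g` is a robust mean of `v₀, …, v_{k-1}` with parameter `α`: in every coordinate, it is the mean
of `(1 - α) k` of the values that are nearest to the median (ties are broken arbitrarily). -/
def IsRobustMean {d k : ℕ} (α : ℝ) (v : Fin k → Vec d) (g : Vec d) : Prop :=
  ∀ j : Fin d, ∃ c : ℝ, IsMedian (fun i => v i j) c ∧
    ∃ S : Finset (Fin k), (S.card : ℝ) = (1 - α) * k ∧
      (∀ i ∈ S, ∀ i' ∉ S, |v i j - c| ≤ |v i' j - c|) ∧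
      g j = (1 / ((1 - α) * k)) * ∑ i ∈ S, v i j

/-- `p` is the Euclidean projection of `y` on `X`. -/
def IsProjection {d : ℕ} (X : Set (Vec d)) (y p : Vec d) : Prop :=
  p ∈ X ∧ ∀ q ∈ X, ‖y - p‖ ≤ ‖y - q‖

/-- `x₁, …, x_{K+1}` are iterates of `K` iterations of the algorithm, for the sequence `W` of
configurations and the local gradients `localGrad`. `g`, `gh`, `gg` are the received feedback, the
temporally robustified gradients and the robust aggregates. The feedback of a Byzantine agent is
arbitrary. If the aggregate is `0`, then its normalization is `0`. -/
def IsRangeRun {d N : ℕ} (X : Set (Vec d)) (localGrad : Fin N → Vec d → Vec d)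
    (m : ℕ) (α₁ α₂ γ : ℝ) (K : ℕ) (W : ℕ → Config N) (x₁ : Vec d) (x : ℕ → Vec d) : Prop :=
  x 1 = x₁ ∧
  ∃ (g gh : ℕ → Fin N → Vec d) (gg : ℕ → Vec d), ∀ t, 1 ≤ t → t ≤ K →
    (∀ i, W t i = 0 → g t i = localGrad i (x t)) ∧
    (t < m → ∀ i, gh t i = g t i) ∧
    (m ≤ t → ∀ i, IsRobustMean α₁ (fun τ : Fin m => g (t - τ) i) (gh t i)) ∧
    IsRobustMean α₂ (gh t) (gg t) ∧
    IsProjection X (x t - γ • (‖gg t‖⁻¹ • gg t)) (x (t + 1))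

/-! ### The constants -/

/-- `C_α` in dimension `d`. -/
def robustConst (d : ℕ) (α : ℝ) : ℝ :=
  2 * α / (1 - α) * (1 + √((1 - α) ^ 2 / (1 - 2 * α))) * √d

/-- The contraction constant `c₀`, for condition number `κ`, diameter `R` and failure bound `pZ`. -/
def contractionConst (κ R pZ : ℝ) : ℝ :=
  2 / (κ * R) * (1 - pZ * (1 + κ))

/-- The constant `C̄` in the bound on the step size. -/
def stepConst (d m m₀ : ℕ) (α₁ α₂ κ pZ : ℝ) : ℝ :=
  1 + 4 * pZ * (1 + 1 / κ) * ((m : ℝ) - 1 + m₀) +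
    4 * κ * ((m : ℝ) - 1) *
      (1 + robustConst d α₁ + 2 * robustConst d α₂ * (robustConst d α₁ + 1))

end

end RangeSAA

/-! Since the step is normalized, an iterate moves by at most `γ` per iteration, whatever the
Byzantine agents send (`IsRangeRun.norm_sub_le`). The genuine gradients in an agent's window of
length `m` therefore lie within `L γ (m - 1)` of its current empirical gradient, and the temporal
robust mean recovers that gradient up to three times this drift if the agent was Byzantine at most
`α₁ m` times. Outside the failure event this holds for at least `(1 - α₂) N` agents, and the second
robust mean is close to `∇F(x_t)` (`norm_aggregate_sub_le`). With aggregate error `e`, the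
normalized direction has inner product at least `‖x_t - x⋆‖ / κ - (1 + 1/κ) e / μ` with `x_t - x⋆`
(`le_inner_normalize`); on the failure event it is still at least `-‖x_t - x⋆‖`.

The failure event and `x_t` are dependent. Replacing `x_t` by the iterate at the start of the
conditioning block costs one drift term and makes the Markov bound applicable
(`IsAgentChain.integral_windowFails_le`). The outcome is a recursion for `E‖x_t - x⋆‖²` with a
decrease proportional to `E‖x_t - x⋆‖` (`integral_norm_sub_sq_le`), and `‖x_t - x⋆‖² ≤ R ‖x_t - x⋆‖`
turns it into a contraction.

The data are drawn once, so `x_t` depends on them and the gradient noise must be controlled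
uniformly on `X`. At one point it is sub-gamma; its increments are bounded, because the gradients
are Lipschitz, hence sub-Gaussian. Chaining over dyadic nets (`exists_uniform_bound`) then gives the
pointwise order up to a constant. This is used twice: for the pooled average of all `N b` samples,
giving `1/√(N b)`, and for the worst single agent, whose deviation enters only with the factor `α₂`
(`IsRobustMean.abs_sub_le_sum`). -/

namespace RangeSAA

/-! ### Sub-gamma random variables -/

/-- `Y` is sub-gamma with variance factor `s` and scale `a`. -/
def IsSubGamma {Ω : Type*} [MeasurableSpace Ω] (P : Measure Ω) (Y : Ω → ℝ) (s a : ℝ) : Prop :=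
  ∀ l : ℝ, a * |l| < 1 →
    Integrable (fun ω => Real.exp (l * Y ω)) P ∧
      ∫ ω, Real.exp (l * Y ω) ∂P ≤ Real.exp (l ^ 2 * s ^ 2 / (2 * (1 - a * |l|)))

namespace IsSubGamma

variable {Ω : Type*} [MeasurableSpace Ω] {P : Measure Ω} {Y : Ω → ℝ} {s a : ℝ}

theorem neg (h : IsSubGamma P Y s a) : IsSubGamma P (fun ω => -Y ω) s a := by
  intro l hl
  have := h (-l) (by simpa using hl)
  simpa using this

theorem exists_admissible_pos (ha : 0 ≤ a) : ∃ l : ℝ, 0 < l ∧ a * l < 1 := by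
  refine ⟨1 / (a + 1), by positivity, ?_⟩
  rw [mul_one_div, div_lt_one (by positivity)]
  linarith

theorem aemeasurable (h : IsSubGamma P Y s a) (ha : 0 ≤ a) : AEMeasurable Y P := by
  obtain ⟨l, hl, hal⟩ := exists_admissible_pos ha
  have h1 := (h l (by rwa [abs_of_pos hl])).1.aestronglyMeasurable.aemeasurable
  have h2 := (Real.measurable_log.comp_aemeasurable h1).const_mul l⁻¹
  refine h2.congr (Filter.Eventually.of_forall fun ω => ?_)
  simp [hl.ne']

/-- Exponential moments at both `l` and `-l` dominate `l |Y|`. -/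
theorem integrable (h : IsSubGamma P Y s a) (ha : 0 ≤ a) : Integrable Y P := by
  obtain ⟨l, hl, hal⟩ := exists_admissible_pos ha
  have h1 := (h l (by rwa [abs_of_pos hl])).1
  have h2 := (h (-l) (by rwa [abs_neg, abs_of_pos hl])).1
  refine ((h1.add h2).const_mul l⁻¹).mono' (h.aemeasurable ha).aestronglyMeasurable
    (Filter.Eventually.of_forall fun ω => ?_)
  have e1 := Real.add_one_le_exp (l * Y ω)
  have e2 := Real.add_one_le_exp (-l * Y ω)
  have p1 := Real.exp_pos (l * Y ω)
  have p2 := Real.exp_pos (-l * Y ω)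
  rw [Real.norm_eq_abs, Pi.add_apply, ← div_eq_inv_mul, le_div_iff₀ hl]
  rcases abs_cases (Y ω) with ⟨e, _⟩ | ⟨e, _⟩ <;> rw [e] <;> nlinarith

/-- The moment bound is `1 + O(l²)` while `exp (l Y) ≥ 1 + l Y`, so the mean is `O(l)` as `l → 0`.
Applied to `Y` and `-Y`, this yields unbiasedness of the stochastic gradients, which is not among
the assumptions. -/
theorem integral_le_zero [IsProbabilityMeasure P] (h : IsSubGamma P Y s a) (ha : 0 ≤ a) :
    ∫ ω, Y ω ∂P ≤ 0 := by
  by_contra! hc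
  set e := ∫ ω, Y ω ∂P with he
  have key : ∀ l : ℝ, 0 < l → a * l ≤ 1 / 2 → l * s ^ 2 ≤ 1 / l → e ≤ 2 * l * s ^ 2 := by
    intro l hl hal hls
    obtain ⟨h1, h2⟩ := h l (by rw [abs_of_pos hl]; linarith)
    rw [abs_of_pos hl] at h2
    have h3 : 1 + l * e ≤ ∫ ω, Real.exp (l * Y ω) ∂P := by
      have : ∫ ω, (1 + l * Y ω) ∂P = 1 + l * e := by
        rw [integral_add (integrable_const _) ((h.integrable ha).const_mul l), integral_const_mul]
        simp [he]
      rw [← this]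
      refine integral_mono ((integrable_const _).add ((h.integrable ha).const_mul l)) h1 fun ω => ?_
      have := Real.add_one_le_exp (l * Y ω)
      show 1 + l * Y ω ≤ _
      linarith
    set u := l ^ 2 * s ^ 2 with hu
    have hu1 : u ≤ 1 := by
      rw [le_div_iff₀ hl] at hls
      nlinarith
    have hu0 : 0 ≤ u := by positivity
    have h4 : u / (2 * (1 - a * l)) ≤ u := by
      rw [div_le_iff₀ (by linarith)]
      nlinarith
    have h5 : Real.exp u ≤ 1 + 2 * u := by
      have := Real.abs_exp_sub_one_le (x := u) (by rwa [abs_of_nonneg hu0])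
      rw [abs_of_nonneg hu0] at this
      linarith [le_abs_self (Real.exp u - 1)]
    have h6 : l * e ≤ l * (2 * l * s ^ 2) := by
      have := Real.exp_le_exp.2 h4
      nlinarith
    exact le_of_mul_le_mul_left h6 hl
  -- For `l = 1 / q`, the summand `2 * a` gives `a l ≤ 1/2`, `|s|` gives `l² s² ≤ 1`, and `4 * s ^ 2
  -- / e` makes `2 l s²` smaller than `e`.
  set q := 2 * a + 4 * s ^ 2 / e + |s| + 1 with hq
  have hq0 : 0 < q := by positivity
  have := key (1 / q) (by positivity) ?_ ?_
  · have h2 : 2 * (1 / q) * s ^ 2 < e := by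
      rw [show 2 * (1 / q) * s ^ 2 = 2 * s ^ 2 / q by ring, div_lt_iff₀ hq0, hq]
      have : e * (4 * s ^ 2 / e) = 4 * s ^ 2 := by field_simp
      nlinarith [mul_nonneg hc.le ha, mul_nonneg hc.le (abs_nonneg s), sq_nonneg s]
    linarith
  · rw [mul_one_div, div_le_iff₀ hq0, hq]
    have : 0 ≤ 4 * s ^ 2 / e := by positivity
    linarith [abs_nonneg s]
  · have h1 : |s| ≤ q := by
      have : 0 ≤ 4 * s ^ 2 / e := by positivity
      rw [hq]; linarith
    have h2 : s ^ 2 ≤ q ^ 2 := by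
      rw [← sq_abs s]; exact pow_le_pow_left₀ (abs_nonneg s) h1 2
    rw [one_div_one_div, one_div_mul_eq_div, div_le_iff₀ hq0]
    linarith [sq q]

theorem integral_eq_zero [IsProbabilityMeasure P] (h : IsSubGamma P Y s a) (ha : 0 ≤ a) :
    ∫ ω, Y ω ∂P = 0 := by
  refine le_antisymm (h.integral_le_zero ha) ?_
  have := h.neg.integral_le_zero ha
  rw [integral_neg] at this
  linarith

/-- The average of `n` independent copies of a sub-gamma variable. -/
theorem average [IsProbabilityMeasure P] {Z : Type*} [MeasurableSpace Z] {D : Measure Z}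
    {φ : Z → ℝ} (h : IsSubGamma D φ s a) (ha : 0 ≤ a) {n : Type*} [Fintype n] [Nonempty n]
    {y : n → Ω → Z} (hy : ∀ j, Measurable (y j)) (hD : ∀ j, P.map (y j) = D)
    (hind : iIndepFun y P) :
    IsSubGamma P (fun ω => (1 / (Fintype.card n : ℝ)) * ∑ j, φ (y j ω))
      (s / √(Fintype.card n : ℝ)) (a / (Fintype.card n : ℝ)) := by
  intro l hl
  set c : ℝ := (Fintype.card n : ℝ) with hc
  have hc0 : 0 < c := by rw [hc]; exact_mod_cast Fintype.card_pos
  have hl' : a * |l / c| < 1 := by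
    rw [abs_div, abs_of_pos hc0]
    calc a * (|l| / c) = a / c * |l| := by ring
      _ < 1 := hl
  obtain ⟨-, h2⟩ := h (l / c) hl'
  have hm := h.aemeasurable ha
  have hm' : ∀ j, AEMeasurable φ (P.map (y j)) := fun j => by rw [hD]; exact hm
  have hind' := hind.comp₀ (fun _ => φ) (fun j => (hy j).aemeasurable) hm'
  have hmgf := hind'.mgf_sum₀ (t := l / c) (fun j => (hm' j).comp_aemeasurable (hy j).aemeasurable)
    Finset.univ
  have hone : ∀ j, mgf (φ ∘ y j) P (l / c) = ∫ z, Real.exp (l / c * φ z) ∂D := by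
    intro j
    rw [mgf, ← hD j, integral_map (hy j).aemeasurable]
    · rfl
    · rw [hD]; exact (h (l / c) hl').1.aestronglyMeasurable
  have hpos : 0 < ∫ z, Real.exp (l / c * φ z) ∂D := by
    have : NeZero D := ⟨by
      rintro rfl
      have j : n := Classical.arbitrary n
      have := Measure.isProbabilityMeasure_map (μ := P) (hy j).aemeasurable
      rw [hD j] at this
      exact IsProbabilityMeasure.ne_zero (0 : Measure Z) rfl⟩
    exact integral_exp_pos (h (l / c) hl').1
  have hfun : (fun ω => Real.exp (l * ((1 / c) * ∑ j, φ (y j ω)))) =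
      fun ω => Real.exp (l / c * (∑ j, φ ∘ y j) ω) := by
    funext ω
    simp only [Finset.sum_apply, Function.comp]
    congr 1; ring
  rw [hfun]
  change _ ∧ mgf (∑ j, φ ∘ y j) P (l / c) ≤ _
  rw [hmgf]
  simp only [hone, Finset.prod_const, Finset.card_univ] at hmgf ⊢
  constructor
  -- A non-integrable exponential has integral `0` by convention, whereas the product formula gives
  -- a positive value.
  · by_contra hni
    rw [mgf, integral_undef hni] at hmgf
    exact (pow_pos hpos _).ne hmgf
  · refine (pow_le_pow_left₀ hpos.le h2 _).trans ?_
    rw [← Real.exp_nat_mul, Real.exp_le_exp, ← hc, div_pow, div_pow s, Real.sq_sqrt hc0.le,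
      show a / c * |l| = a * |l / c| by rw [abs_div, abs_of_pos hc0]; ring]
    apply le_of_eq
    have : 1 - a * |l / c| ≠ 0 := by linarith
    field_simp

/-- A maximal inequality for finitely many sub-gamma variables. -/
theorem exists_abs_le [IsProbabilityMeasure P] {ι : Type*} (I : Finset ι) {V : ι → Ω → ℝ}
    (hs : 0 < s) (ha : 0 ≤ a) (h : ∀ i ∈ I, IsSubGamma P (V i) s a) {M : ℝ} (hM : 1 < M)
    (hI : 2 * (I.card : ℝ) ≤ M) :
    ∃ B : Ω → ℝ, Integrable B P ∧ (∀ ω, ∀ i ∈ I, |V i ω| ≤ B ω) ∧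
      ∫ ω, B ω ∂P ≤ 2 * s * √(Real.log M) + 2 * a * Real.log M := by
  have hlog : 0 < Real.log M := Real.log_pos hM
  have hsq : 0 < √(Real.log M) := Real.sqrt_pos.2 hlog
  -- The usual optimal `l = √(log M) / s`, damped by `2 * a` so that `a l ≤ 1/2`; then the exponent
  -- of each moment bound is at most `v = l² s²`.
  set p := s / √(Real.log M) + 2 * a with hp
  have hp0 : 0 < p := by positivity
  set l := 1 / p with hl
  have hl0 : 0 < l := by positivity
  have hal : a * l ≤ 1 / 2 := by
    rw [hl, mul_one_div, div_le_iff₀ hp0, hp]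
    have : 0 < s / √(Real.log M) := by positivity
    linarith
  set v := l ^ 2 * s ^ 2 with hv
  have hls : l * s ≤ √(Real.log M) := by
    rw [hl, one_div_mul_eq_div, div_le_iff₀ hp0, hp, mul_add, mul_div_cancel₀ _ hsq.ne']
    linarith [mul_nonneg hsq.le ha]
  have hMe : 0 < M * Real.exp v := by positivity
  have hV : ∀ i ∈ I, ∀ l' : ℝ, |l'| = l → Integrable (fun ω => Real.exp (l' * V i ω)) P ∧
      ∫ ω, Real.exp (l' * V i ω) ∂P ≤ Real.exp v := by
    intro i hi l' hl'
    obtain ⟨h1, h2⟩ := h i hi l' (by rw [hl']; linarith)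
    refine ⟨h1, h2.trans (Real.exp_le_exp.2 ?_)⟩
    rw [hl', ← sq_abs l', hl', ← hv, div_le_iff₀ (by linarith)]
    have : 0 ≤ v := by positivity
    nlinarith
  have hp1 := fun i hi => hV i hi l (abs_of_pos hl0)
  have hp2 := fun i hi => hV i hi (-l) (by rw [abs_neg, abs_of_pos hl0])
  set S : Ω → ℝ := fun ω => ∑ i ∈ I, (Real.exp (l * V i ω) + Real.exp (-l * V i ω)) with hS
  have hSint : Integrable S P := integrable_finsetSum _ fun i hi => (hp1 i hi).1.add (hp2 i hi).1
  have hSle : ∫ ω, S ω ∂P ≤ M * Real.exp v := by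
    rw [hS, integral_finsetSum I (f := fun i ω => Real.exp (l * V i ω) + Real.exp (-l * V i ω))
      fun i hi => (hp1 i hi).1.add (hp2 i hi).1]
    calc ∑ i ∈ I, ∫ ω, (Real.exp (l * V i ω) + Real.exp (-l * V i ω)) ∂P
        ≤ ∑ i ∈ I, 2 * Real.exp v := Finset.sum_le_sum fun i hi => by
          rw [integral_add (hp1 i hi).1 (hp2 i hi).1]
          linarith [(hp1 i hi).2, (hp2 i hi).2]
      _ = 2 * I.card * Real.exp v := by rw [Finset.sum_const, nsmul_eq_mul]; ring
      _ ≤ M * Real.exp v := by gcongr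
  -- The tangent to the logarithm at `M * exp v`, applied to `S`. It replaces Jensen's inequality
  -- for the maximum and gives an explicit integrable majorant.
  refine ⟨fun ω => (Real.log M + v + S ω / (M * Real.exp v) - 1) / l, ?_, ?_, ?_⟩
  · exact (((integrable_const _).add (hSint.div_const _)).sub (integrable_const _)).div_const _
  · intro ω i hi
    have hterm : Real.exp (l * V i ω) + Real.exp (-l * V i ω) ≤ S ω :=
      Finset.single_le_sum (f := fun i => Real.exp (l * V i ω) + Real.exp (-l * V i ω))
        (fun i _ => by positivity) hi
    have key : ∀ y : ℝ, Real.exp (l * y) ≤ S ω →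
        y ≤ (Real.log M + v + S ω / (M * Real.exp v) - 1) / l := by
      intro y hy
      rw [le_div_iff₀ hl0]
      have h1 := Real.add_one_le_exp (l * y - (Real.log M + v))
      rw [Real.exp_sub, Real.exp_add, Real.exp_log (by linarith)] at h1
      have h2 : Real.exp (l * y) / (M * Real.exp v) ≤ S ω / (M * Real.exp v) := by gcongr
      linarith
    have e1 := Real.exp_pos (l * V i ω)
    have e2 := Real.exp_pos (-l * V i ω)
    refine abs_le'.2 ⟨key _ (by linarith), key _ ?_⟩
    rw [show l * -V i ω = -l * V i ω by ring]
    linarith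
  · have e : ∫ ω, (Real.log M + v + S ω / (M * Real.exp v) - 1) / l ∂P =
        (Real.log M + v + (∫ ω, S ω ∂P) / (M * Real.exp v) - 1) / l := by
      have i1 : Integrable (fun ω => Real.log M + v + S ω / (M * Real.exp v)) P :=
        (integrable_const _).add (hSint.div_const _)
      rw [integral_div, integral_sub i1 (integrable_const _),
        integral_add (integrable_const _) (hSint.div_const _), integral_div]
      simp
    rw [e]
    have h1 : (∫ ω, S ω ∂P) / (M * Real.exp v) ≤ 1 := (div_le_one hMe).2 hSle
    have h2 : Real.log M / l = s * √(Real.log M) + 2 * a * Real.log M := by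
      rw [hl, div_div_eq_mul_div, div_one, hp]
      nth_rewrite 1 [← Real.mul_self_sqrt hlog.le]
      field_simp
      linear_combination (2 * a) * Real.mul_self_sqrt hlog.le
    calc _ ≤ (Real.log M + v) / l := by gcongr; linarith
      _ = Real.log M / l + s * (l * s) := by rw [add_div, hv]; field_simp
      _ ≤ _ := by rw [h2]; nlinarith

/-- A bounded variable is sub-gamma (with scale `0`) after centering. -/
theorem of_abs_le [IsProbabilityMeasure P] (hY : AEMeasurable Y P) {r : ℝ} (hr : 0 ≤ r)
    (h : ∀ ω, |Y ω| ≤ r) : IsSubGamma P (fun ω => Y ω - ∫ ω', Y ω' ∂P) r 0 := by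
  have := hasSubgaussianMGF_of_mem_Icc hY
    (Filter.Eventually.of_forall fun ω => (⟨(abs_le.1 (h ω)).1, (abs_le.1 (h ω)).2⟩ :
      Y ω ∈ Set.Icc (-r) r))
  intro l _
  refine ⟨this.integrable_exp_mul l, (this.mgf_le l).trans (Real.exp_le_exp.2 (le_of_eq ?_))⟩
  have e : r - -r = 2 * r := by ring
  simp only [NNReal.coe_pow, NNReal.coe_div, coe_nnnorm, NNReal.coe_ofNat, e, Real.norm_eq_abs]
  rw [abs_of_nonneg (by linarith)]
  ring

end IsSubGamma

/-! ### Uniform deviations: chaining over dyadic nets -/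

theorem norm_le_sqrt_mul {d : ℕ} {v : Vec d} {r : ℝ} (hr : 0 ≤ r) (h : ∀ j, |v j| ≤ r) :
    ‖v‖ ≤ √d * r := by
  rw [EuclideanSpace.norm_eq]
  refine Real.sqrt_le_iff.2 ⟨by positivity, ?_⟩
  rw [mul_pow, Real.sq_sqrt (Nat.cast_nonneg d)]
  calc ∑ i, ‖v i‖ ^ 2 ≤ ∑ _i : Fin d, r ^ 2 :=
        Finset.sum_le_sum fun i _ => pow_le_pow_left₀ (norm_nonneg _) (h i) 2
    _ = d * r ^ 2 := by simp

theorem abs_apply_le_norm {d : ℕ} (v : Vec d) (j : Fin d) : |v j| ≤ ‖v‖ :=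
  PiLp.norm_apply_le v j

-- Cut the cube of half-side `R` around `xs` into cells of side `R / 2 ^ k` and choose a point of
-- `X` in each cell that meets `X`; points of one cell differ by at most the side in every
-- coordinate. The index runs up to `2 ^ (k + 1)` inclusive, so `2 ^ (k + 2)` values per axis
-- suffice.
open Classical in
theorem exists_net {d : ℕ} {X : Set (Vec d)} {xs : Vec d} {R : ℝ} (hR : 0 < R)
    (hX : ∀ x ∈ X, ‖x - xs‖ ≤ R) (k : ℕ) :
    ∃ A : Finset (Vec d), (∀ x ∈ A, x ∈ X) ∧ A.card ≤ 2 ^ ((k + 2) * d) ∧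
      ∀ x ∈ X, ∃ y ∈ A, ‖x - y‖ ≤ √d * (R / 2 ^ k) := by
  let key : Vec d → Fin d → ℕ := fun x j => ⌊(x j - xs j + R) / (R / 2 ^ k)⌋₊
  let rep : (Fin d → ℕ) → Vec d := fun c => if h : ∃ x ∈ X, key x = c then h.choose else xs
  have hrep : ∀ x ∈ X, rep (key x) ∈ X ∧ key (rep (key x)) = key x := by
    intro x hx
    have h : ∃ y ∈ X, key y = key x := ⟨x, hx, rfl⟩
    have e : rep (key x) = h.choose := dif_pos h
    rw [e]
    exact h.choose_spec
  have hr : 0 < R / 2 ^ k := by positivity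
  have hcoord : ∀ x ∈ X, ∀ j, 0 ≤ x j - xs j + R ∧ x j - xs j + R ≤ 2 * R := by
    intro x hx j
    have := (abs_apply_le_norm (x - xs) j).trans (hX x hx)
    rw [PiLp.sub_apply, abs_le] at this
    constructor <;> linarith
  have hkey : ∀ x ∈ X, key x ∈ Fintype.piFinset fun _ : Fin d => Finset.range (2 ^ (k + 2)) := by
    intro x hx
    rw [Fintype.mem_piFinset]
    intro j
    rw [Finset.mem_range, Nat.floor_lt (div_nonneg (hcoord x hx j).1 hr.le), div_lt_iff₀ hr]
    refine (hcoord x hx j).2.trans_lt ?_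
    push_cast
    rw [pow_add]
    have : (2 : ℝ) ^ k * 2 ^ 2 * (R / 2 ^ k) = 4 * R := by field_simp; norm_num
    linarith
  refine ⟨((Fintype.piFinset fun _ : Fin d => Finset.range (2 ^ (k + 2))).image rep).filter (· ∈ X),
    fun x hx => (Finset.mem_filter.1 hx).2, ?_, ?_⟩
  · refine (Finset.card_filter_le _ _).trans (Finset.card_image_le.trans ?_)
    simp [Fintype.card_piFinset, ← pow_mul]
  · intro x hx
    refine ⟨rep (key x), Finset.mem_filter.2 ⟨Finset.mem_image_of_mem _ (hkey x hx),
      (hrep x hx).1⟩, norm_le_sqrt_mul hr.le fun j => ?_⟩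
    have h1 := congrFun (hrep x hx).2 j
    set y := rep (key x) with hy
    have h2 := Nat.floor_le (div_nonneg (hcoord x hx j).1 hr.le)
    have h3 := Nat.lt_floor_add_one ((x j - xs j + R) / (R / 2 ^ k))
    have h4 := Nat.floor_le (div_nonneg (hcoord y (hrep x hx).1 j).1 hr.le)
    have h5 := Nat.lt_floor_add_one ((y j - xs j + R) / (R / 2 ^ k))
    change ⌊(y j - xs j + R) / (R / 2 ^ k)⌋₊ = ⌊(x j - xs j + R) / (R / 2 ^ k)⌋₊ at h1
    rw [h1] at h4 h5
    rw [le_div_iff₀ hr] at h2 h4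
    rw [div_lt_iff₀ hr] at h3 h5
    rw [PiLp.sub_apply, abs_le]
    constructor <;> nlinarith

/-- Level `0` is replaced by the single point `xs`, so that every chain starts at the point where
the sub-gamma bound is applied. -/
theorem exists_dyadic_nets {d : ℕ} (hd : 1 ≤ d) {X : Set (Vec d)} {xs : Vec d} (hxs : xs ∈ X)
    {R : ℝ} (hR : 0 < R) (hX : ∀ x ∈ X, ‖x - xs‖ ≤ R) :
    ∃ A : ℕ → Finset (Vec d), A 0 = {xs} ∧ (∀ k, ∀ x ∈ A k, x ∈ X) ∧
      (∀ k, (A k).card ≤ 2 ^ ((k + 2) * d)) ∧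
      ∀ k, ∀ x ∈ X, ∃ y ∈ A k, ‖x - y‖ ≤ √d * (R / 2 ^ k) := by
  choose A h1 h2 h3 using exists_net (X := X) (xs := xs) hR hX
  refine ⟨fun k => if k = 0 then {xs} else A k, by simp, fun k => ?_, fun k => ?_, fun k => ?_⟩
  all_goals rcases eq_or_ne k 0 with rfl | hk
  · simpa using hxs
  · simpa [hk] using h1 k
  · simpa using Nat.one_le_two_pow
  · simpa [hk] using h2 k
  · intro x hx
    refine ⟨xs, by simp, (hX x hx).trans ?_⟩
    have : 1 ≤ √(d : ℝ) := Real.one_le_sqrt.2 (by exact_mod_cast hd)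
    simp only [pow_zero, div_one]
    nlinarith
  · simpa [hk] using h3 k

theorem sum_dyadic_le (K : ℕ) : ∑ k ∈ Finset.range K, (2 * (k : ℝ) + 6) / 2 ^ k ≤ 16 := by
  have : ∀ K : ℕ, ∑ k ∈ Finset.range K, (2 * (k : ℝ) + 6) / 2 ^ k = 16 - (4 * K + 16) / 2 ^ K := by
    intro K
    induction K with
    | zero => norm_num
    | succ n ih =>
      rw [Finset.sum_range_succ, ih]
      push_cast
      field_simp
      ring
  rw [this K]
  have : (0 : ℝ) ≤ (4 * K + 16) / 2 ^ K := by positivity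
  linarith

/-- A random field with sub-Gaussian increments is dominated by an integrable variable. -/
theorem exists_uniform_bound {d : ℕ} (hd : 1 ≤ d) {X : Set (Vec d)} {xs : Vec d} (hxs : xs ∈ X)
    {R : ℝ} (hR : 0 < R) (hX : ∀ x ∈ X, ‖x - xs‖ ≤ R) {Ω : Type*} [MeasurableSpace Ω]
    {P : Measure Ω} [IsProbabilityMeasure P] {ι : Type*} [Fintype ι] [Nonempty ι]
    (h : ι → Fin d → Vec d → Ω → ℝ) {s a q L : ℝ} (hs : 0 < s) (ha : 0 ≤ a) (hq : 0 < q)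
    (hL : 0 < L) (hbase : ∀ i j, IsSubGamma P (h i j xs) s a)
    (hinc : ∀ i j, ∀ x ∈ X, ∀ y ∈ X, ∀ r, ‖x - y‖ ≤ r →
      IsSubGamma P (fun ω => h i j x ω - h i j y ω) (q * r) 0)
    (hlip : ∀ i j ω, ∀ x ∈ X, ∀ y ∈ X, |h i j x ω - h i j y ω| ≤ L * ‖x - y‖)
    {ε : ℝ} (hε : 0 < ε) :
    ∃ B : Ω → ℝ, Integrable B P ∧ (∀ ω i j, ∀ x ∈ X, |h i j x ω| ≤ B ω) ∧
      ∫ ω, B ω ∂P ≤ (2 * s + 64 * q * √d * R * d) * √(Real.log (2 * d * Fintype.card ι)) +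
        2 * a * Real.log (2 * d * Fintype.card ι) + ε := by
  obtain ⟨A, hA0, hAX, hAc, hAd⟩ := exists_dyadic_nets hd hxs hR hX
  have hd1 : (1 : ℝ) ≤ d := by exact_mod_cast hd
  have hsd : 0 < √(d : ℝ) := Real.sqrt_pos.2 (by linarith)
  have hc1 : (1 : ℝ) ≤ Fintype.card ι := by exact_mod_cast Fintype.card_pos
  set M : ℝ := 2 * d * Fintype.card ι with hM
  have hM2 : 2 ≤ M := by rw [hM]; nlinarith
  have hlog2 : Real.log 2 ≤ Real.log M := Real.log_le_log (by norm_num) hM2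
  have hlog2' : 0 < Real.log 2 := Real.log_pos (by norm_num)
  set Λ := Real.log M with hΛ
  -- the base point
  obtain ⟨B₀, hB₀i, hB₀, hB₀e⟩ := IsSubGamma.exists_abs_le (P := P)
    (Finset.univ : Finset (ι × Fin d)) (V := fun p => h p.1 p.2 xs) hs ha
    (fun p _ => hbase p.1 p.2) (M := M) (by linarith)
    (by simp [hM]; apply le_of_eq; ring)
  -- the increments
  have hlev : ∀ k : ℕ, ∃ B : Ω → ℝ, Integrable B P ∧
      (∀ ω i j, ∀ x ∈ A k, ∀ y ∈ A (k + 1), ‖x - y‖ ≤ 2 * (√d * (R / 2 ^ k)) →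
        |h i j x ω - h i j y ω| ≤ B ω) ∧
      ∫ ω, B ω ∂P ≤ 4 * q * √d * R * d * √Λ * ((2 * k + 6) / 2 ^ k) := by
    intro k
    classical
    set J : Finset ((ι × Fin d) × (Vec d × Vec d)) := (Finset.univ : Finset (ι × Fin d)) ×ˢ
        ((A k ×ˢ A (k + 1)).filter fun p => ‖p.1 - p.2‖ ≤ 2 * (√d * (R / 2 ^ k))) with hJ
    have hV : ∀ p ∈ J, IsSubGamma P (fun ω => h p.1.1 p.1.2 p.2.1 ω - h p.1.1 p.1.2 p.2.2 ω)
        (q * (2 * (√d * (R / 2 ^ k)))) 0 := by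
      intro p hp
      simp only [hJ, Finset.mem_product, Finset.mem_univ, true_and, Finset.mem_filter] at hp
      exact hinc _ _ _ (hAX _ _ hp.1.1) _ (hAX _ _ hp.1.2) _ hp.2
    have hM1 : 1 < M * 2 ^ ((2 * k + 5) * d) := by
      have : (1 : ℝ) ≤ 2 ^ ((2 * k + 5) * d) := one_le_pow₀ (by norm_num)
      nlinarith
    have hJc : 2 * (J.card : ℝ) ≤ M * 2 ^ ((2 * k + 5) * d) := by
      rw [hJ, Finset.card_product, Finset.card_univ, Fintype.card_prod, Fintype.card_fin]
      have hcard : ((A k ×ˢ A (k + 1)).filter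
          fun p => ‖p.1 - p.2‖ ≤ 2 * (√d * (R / 2 ^ k))).card ≤ 2 ^ ((2 * k + 5) * d) := by
        refine (Finset.card_filter_le _ _).trans ?_
        rw [Finset.card_product]
        refine (Nat.mul_le_mul (hAc k) (hAc (k + 1))).trans (le_of_eq ?_)
        rw [← pow_add]; ring_nf
      have hcard' : ((((A k ×ˢ A (k + 1)).filter
          fun p => ‖p.1 - p.2‖ ≤ 2 * (√d * (R / 2 ^ k))).card : ℕ) : ℝ) ≤
            2 ^ ((2 * k + 5) * d) := by exact_mod_cast hcard
      push_cast
      have := mul_le_mul_of_nonneg_left hcard' (show 0 ≤ M by linarith)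
      rw [hM] at this ⊢
      linarith
    obtain ⟨B, h1, h2, h3⟩ := IsSubGamma.exists_abs_le J (by positivity) le_rfl hV hM1 hJc
    refine ⟨B, h1, ?_, h3.trans ?_⟩
    · intro ω i j x hx y hy hxy
      exact h2 ω ((i, j), (x, y)) (by simp [hJ, hx, hy, hxy])
    · rw [Real.log_mul (by positivity) (by positivity), Real.log_pow, ← hΛ]
      have hk6 : (0 : ℝ) ≤ (2 * k + 6) * d := by positivity
      -- The entropy of the pairs is absorbed into `Λ ≥ log 2`. Bounding the square root of `(2 k +
      -- 6) d` by the number itself is harmless, since the radii decay geometrically.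
      have e1 : √(Λ + ((2 * k + 5) * d : ℕ) * Real.log 2) ≤ √Λ * ((2 * k + 6) * d) := by
        have : 1 ≤ (2 * (k : ℝ) + 6) * d := by
          have : (0 : ℝ) ≤ k := Nat.cast_nonneg k
          nlinarith
        rw [← Real.sqrt_sq hk6, ← Real.sqrt_mul (by linarith)]
        refine Real.sqrt_le_sqrt ?_
        push_cast
        have h5 : (0 : ℝ) ≤ (2 * k + 5) * d := by positivity
        calc Λ + (2 * k + 5) * d * Real.log 2 ≤ Λ + (2 * k + 5) * d * Λ := by gcongr
          _ = Λ * (1 + (2 * k + 5) * d) := by ring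
          _ ≤ Λ * ((2 * k + 6) * d) := by
            refine mul_le_mul_of_nonneg_left ?_ (by linarith)
            linarith
          _ ≤ Λ * ((2 * k + 6) * d) ^ 2 := by
            refine mul_le_mul_of_nonneg_left ?_ (by linarith)
            nlinarith
      calc _ ≤ 2 * (q * (2 * (√d * (R / 2 ^ k)))) * (√Λ * ((2 * k + 6) * d)) := by
            have := mul_le_mul_of_nonneg_left e1
              (show 0 ≤ 2 * (q * (2 * (√(d : ℝ) * (R / 2 ^ k)))) by positivity)
            linarith
        _ = _ := by ring
  choose B hBi hB hBe using hlev
  -- The chain stops where the deterministic Lipschitz bound is below `ε`. The depth `K` does not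
  -- enter the final bound because the sum over levels is bounded uniformly in `K`.
  obtain ⟨K, hK⟩ := exists_pow_lt_of_lt_one (show 0 < ε / (L * (√d * R)) by positivity)
    (show (1 / 2 : ℝ) < 1 by norm_num)
  refine ⟨fun ω => B₀ ω + ∑ k ∈ Finset.range K, B k ω + ε,
    (hB₀i.add (integrable_finsetSum _ fun k _ => hBi k)).add (integrable_const _), ?_, ?_⟩
  · intro ω i j x hx
    choose π hπA hπ using fun k => hAd k x hx
    have h0 : π 0 = xs := by have := hπA 0; rwa [hA0, Finset.mem_singleton] at this
    have hstep : ∀ k, |h i j (π k) ω - h i j (π (k + 1)) ω| ≤ B k ω := by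
      intro k
      refine hB k ω i j _ (hπA k) _ (hπA (k + 1)) ?_
      have h1 := hπ k
      have h2 := hπ (k + 1)
      have h3 : √d * (R / 2 ^ (k + 1)) ≤ √d * (R / 2 ^ k) := by
        gcongr
        · norm_num
        · omega
      calc ‖π k - π (k + 1)‖ = ‖(x - π (k + 1)) - (x - π k)‖ := by congr 1; abel
        _ ≤ ‖x - π (k + 1)‖ + ‖x - π k‖ := norm_sub_le _ _
        _ ≤ _ := by linarith
    have htel : ∀ n, |h i j (π n) ω| ≤ B₀ ω + ∑ k ∈ Finset.range n, B k ω := by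
      intro n
      induction n with
      | zero => simpa [h0] using hB₀ ω (i, j) (Finset.mem_univ _)
      | succ n ih =>
        rw [Finset.sum_range_succ]
        have h1 := hstep n
        rw [abs_le] at h1 ih ⊢
        constructor <;> linarith
    have hlast : |h i j x ω - h i j (π K) ω| ≤ ε := by
      refine (hlip i j ω x hx _ (hAX K _ (hπA K))).trans ?_
      have h1 := mul_le_mul_of_nonneg_left (hπ K) hL.le
      refine h1.trans ?_
      rw [lt_div_iff₀ (by positivity)] at hK
      refine le_trans (le_of_eq ?_) hK.le
      rw [one_div, inv_pow]
      field_simp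
    have h2 := htel K
    rw [abs_le] at hlast h2 ⊢
    constructor <;> linarith
  · have i1 : Integrable (fun ω => ∑ k ∈ Finset.range K, B k ω) P :=
      integrable_finsetSum _ fun k _ => hBi k
    rw [integral_add (f := fun ω => B₀ ω + ∑ k ∈ Finset.range K, B k ω) (hB₀i.add i1)
      (integrable_const _), integral_add hB₀i i1, integral_finsetSum _ fun k _ => hBi k]
    have : ∑ k ∈ Finset.range K, ∫ ω, B k ω ∂P ≤ 64 * q * √d * R * d * √Λ := by
      calc _ ≤ ∑ k ∈ Finset.range K, 4 * q * √d * R * d * √Λ * ((2 * k + 6) / 2 ^ k) :=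
            Finset.sum_le_sum fun k _ => hBe k
        _ = 4 * q * √d * R * d * √Λ * ∑ k ∈ Finset.range K, (2 * (k : ℝ) + 6) / 2 ^ k := by
            rw [Finset.mul_sum]
        _ ≤ 4 * q * √d * R * d * √Λ * 16 := by gcongr; exact sum_dyadic_le K
        _ = _ := by ring
    simp only [integral_const, probReal_univ, smul_eq_mul, one_mul]
    linarith

/-! ### The gradient noise -/

section Noise

variable {d : ℕ} {Z : Type*} [MeasurableSpace Z] {D : Measure Z} [IsProbabilityMeasure D]
  {f : Vec d → Z → ℝ} {X : Set (Vec d)} {σ a L : ℝ}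

theorem HasSubGammaNoise.isSubGamma (h : HasSubGammaNoise D f X σ a) {x : Vec d} (hx : x ∈ X)
    (k : Fin d) :
    IsSubGamma D (fun z => gradient (fun y => f y z) x k - gradient (expectedCost D f) x k) σ a := by
  intro l hl
  obtain ⟨h1, h2⟩ := h x hx k l hl
  exact ⟨h1, (Real.log_le_iff_le_exp (integral_exp_pos h1)).1 h2⟩

/-- Both noises are centered, so no interchange of derivative and integral is needed. -/
theorem HasSubGammaNoise.integrable_sub (h : HasSubGammaNoise D f X σ a) (ha : 0 ≤ a)
    {x y : Vec d} (hx : x ∈ X) (hy : y ∈ X) (k : Fin d) :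
    Integrable (fun z => gradient (fun u => f u z) x k - gradient (fun u => f u z) y k) D ∧
      ∫ z, (gradient (fun u => f u z) x k - gradient (fun u => f u z) y k) ∂D =
        gradient (expectedCost D f) x k - gradient (expectedCost D f) y k := by
  have i1 := (h.isSubGamma hx k).integrable ha
  have i2 := (h.isSubGamma hy k).integrable ha
  have e1 := (h.isSubGamma hx k).integral_eq_zero ha
  have e2 := (h.isSubGamma hy k).integral_eq_zero ha
  have e : (fun z => gradient (fun u => f u z) x k - gradient (fun u => f u z) y k) = fun z =>
      ((gradient (fun u => f u z) x k - gradient (expectedCost D f) x k) -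
        (gradient (fun u => f u z) y k - gradient (expectedCost D f) y k)) +
      (gradient (expectedCost D f) x k - gradient (expectedCost D f) y k) := by
    funext z; ring
  rw [e]
  refine ⟨(i1.sub i2).add (integrable_const _), ?_⟩
  have i3 := i1.sub i2
  rw [Pi.sub_def] at i3
  rw [integral_add i3 (integrable_const _), integral_sub i1 i2, e1, e2]
  simp

/-- Pair the difference `v` of the gradients with itself: `‖v‖²` is the mean of the inner products
of `v` with sample gradient differences, each at most `‖v‖ L ‖x - y‖`. -/
theorem norm_gradient_expectedCost_sub_le (h : HasSubGammaNoise D f X σ a) (ha : 0 ≤ a)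
    (hf : ∀ z, IsSmoothOn L X (fun x => f x z)) {x y : Vec d} (hx : x ∈ X) (hy : y ∈ X) :
    ‖gradient (expectedCost D f) x - gradient (expectedCost D f) y‖ ≤ L * ‖x - y‖ := by
  set v := gradient (expectedCost D f) x - gradient (expectedCost D f) y with hv
  rcases eq_or_ne v 0 with h0 | h0
  · rw [h0, norm_zero]
    have : Nonempty Z := by
      by_contra hne
      rw [not_nonempty_iff] at hne
      exact IsProbabilityMeasure.ne_zero D (Measure.eq_zero_of_isEmpty D)
    exact (norm_nonneg _).trans ((hf (Classical.arbitrary Z)).2 x hx y hy)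
  have hi := fun k => h.integrable_sub ha hx hy k
  have hin : ∀ w : Vec d, inner ℝ v w = ∑ k, v k * w k := by
    intro w
    simp [PiLp.inner_apply, mul_comm]
  have hsq : ‖v‖ ^ 2 =
      ∫ z, inner ℝ v (gradient (fun u => f u z) x - gradient (fun u => f u z) y) ∂D := by
    rw [← real_inner_self_eq_norm_sq, hin]
    simp_rw [hin, PiLp.sub_apply]
    rw [integral_finsetSum _ fun k _ => (hi k).1.const_mul _]
    refine Finset.sum_congr rfl fun k _ => ?_
    rw [integral_const_mul, (hi k).2, hv, PiLp.sub_apply]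
  have hle : ‖v‖ ^ 2 ≤ ‖v‖ * (L * ‖x - y‖) := by
    rw [hsq]
    have : ∫ _z, ‖v‖ * (L * ‖x - y‖) ∂D = ‖v‖ * (L * ‖x - y‖) := by simp
    rw [← this]
    refine integral_mono ?_ (integrable_const _) fun z => ?_
    · simp_rw [hin, PiLp.sub_apply]
      exact integrable_finsetSum _ fun k _ => (hi k).1.const_mul _
    · exact (real_inner_le_norm _ _).trans
        (mul_le_mul_of_nonneg_left ((hf z).2 x hx y hy) (norm_nonneg _))
  rw [sq] at hle
  exact le_of_mul_le_mul_left hle (norm_pos_iff.2 h0)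

/-- The averaged gradient noise of every batch is bounded, uniformly on `X`, by a variable whose
expectation is of the order of the noise at a single point. -/
theorem exists_gradient_deviation (hd : 1 ≤ d) (h : HasSubGammaNoise D f X σ a) (hσ : 0 < σ)
    (ha : 0 ≤ a) (hL : 0 < L) (hf : ∀ z, IsSmoothOn L X (fun x => f x z)) {xs : Vec d}
    (hxs : xs ∈ X) {R : ℝ} (hR : 0 < R) (hX : ∀ x ∈ X, ‖x - xs‖ ≤ R) {Ω : Type*}
    [MeasurableSpace Ω] {P : Measure Ω} [IsProbabilityMeasure P] {ι n : Type*} [Fintype ι]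
    [Nonempty ι] [Fintype n] [Nonempty n] {z : ι → n → Ω → Z} (hz : ∀ i j, Measurable (z i j))
    (hD : ∀ i j, P.map (z i j) = D) (hind : ∀ i, iIndepFun (z i) P) :
    ∃ B : Ω → ℝ, Integrable B P ∧
      (∀ ω i, ∀ x ∈ X, ∀ k, |(1 / (Fintype.card n : ℝ)) * ∑ j,
        (gradient (fun u => f u (z i j ω)) x k - gradient (expectedCost D f) x k)| ≤ B ω) ∧
      ∫ ω, B ω ∂P ≤ (2 * σ + 64 * L * √d * R * d + 2 * a + 1) *
        (√(Real.log (2 * d * Fintype.card ι)) / √(Fintype.card n) +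
          Real.log (2 * d * Fintype.card ι) / Fintype.card n) := by
  set c : ℝ := (Fintype.card n : ℝ) with hc
  have hc0 : 0 < c := by rw [hc]; exact_mod_cast Fintype.card_pos
  have hd1 : (1 : ℝ) ≤ d := by exact_mod_cast hd
  have hι : (1 : ℝ) ≤ Fintype.card ι := by exact_mod_cast Fintype.card_pos
  set Λ := Real.log (2 * d * Fintype.card ι) with hΛ
  have hΛ0 : 0 < Λ := Real.log_pos (by nlinarith)
  have hs0 : 0 < √c := Real.sqrt_pos.2 hc0
  obtain ⟨B, hBi, hB, hBe⟩ := exists_uniform_bound hd hxs hR hX (P := P)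
    (fun (i : ι) k x ω => (1 / c) * ∑ j,
        (gradient (fun u => f u (z i j ω)) x k - gradient (expectedCost D f) x k))
    (s := σ / √c) (a := a / c) (q := L / √c) (L := 2 * L) (by positivity) (by positivity)
    (by positivity) (by positivity)
    (fun i k => (h.isSubGamma hxs k).average ha (hz i) (hD i) (hind i))
    (by
      intro i k x hx y hy r hr
      have hr0 : 0 ≤ r := (norm_nonneg _).trans hr
      have hi := h.integrable_sub ha hx hy k
      -- A sample gradient difference is bounded by `L r`, so Hoeffding's lemma makes its centered
      -- version sub-Gaussian, and averaging gains `1/√c`.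
      have h1 := IsSubGamma.of_abs_le hi.1.aemeasurable (r := L * r) (by positivity) (by
        intro w
        rw [← PiLp.sub_apply]
        exact (abs_apply_le_norm _ _).trans (((hf w).2 x hx y hy).trans (by gcongr)))
      have h2 := h1.average le_rfl (hz i) (hD i) (hind i)
      rw [hi.2, ← hc, zero_div, mul_div_right_comm] at h2
      convert h2 using 2 with ω
      rw [← mul_sub, ← Finset.sum_sub_distrib]
      congr 1
      refine Finset.sum_congr rfl fun j _ => ?_
      ring)
    (by
      intro i k ω x hx y hy
      have hterm : ∀ j, |(gradient (fun u => f u (z i j ω)) x k - gradient (expectedCost D f) x k) -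
          (gradient (fun u => f u (z i j ω)) y k - gradient (expectedCost D f) y k)| ≤
            2 * L * ‖x - y‖ := by
        intro j
        have e1 := (abs_apply_le_norm _ k).trans ((hf (z i j ω)).2 x hx y hy)
        have e2 := (abs_apply_le_norm _ k).trans (norm_gradient_expectedCost_sub_le h ha hf hx hy)
        rw [PiLp.sub_apply, abs_le] at e1 e2
        rw [abs_le]
        constructor <;> linarith
      rw [← mul_sub, ← Finset.sum_sub_distrib, abs_mul, abs_of_pos (by positivity)]
      rw [one_div_mul_eq_div, div_le_iff₀ hc0]
      calc _ ≤ ∑ j : n, 2 * L * ‖x - y‖ :=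
            (Finset.abs_sum_le_sum_abs _ _).trans (Finset.sum_le_sum fun j _ => hterm j)
        _ = _ := by rw [Finset.sum_const, Finset.card_univ, nsmul_eq_mul]; ring)
    -- A discretization error of the order of the noise itself; it accounts for the `+ 1` in the
    -- constant.
    (ε := √Λ / √c) (by have := Real.sqrt_pos.2 hΛ0; positivity)
  refine ⟨B, hBi, fun ω i x hx k => hB ω i k x hx, hBe.trans ?_⟩
  have e1 : (2 * (σ / √c) + 64 * (L / √c) * √d * R * d) * √Λ + 2 * (a / c) * Λ + √Λ / √c =
      (2 * σ + 64 * L * √d * R * d + 1) * (√Λ / √c) + 2 * a * (Λ / c) := by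
    field_simp
    ring
  rw [e1]
  have p1 : 0 ≤ √Λ / √c := by positivity
  have p2 : 0 ≤ Λ / c := by positivity
  have p3 : 0 ≤ 2 * σ + 64 * L * √d * R * d + 1 := by positivity
  nlinarith [mul_nonneg p3 p2, mul_nonneg ha p1]

end Noise

/-- The gradient of the empirical risk is the average of the gradients. -/
theorem gradient_empiricalRisk {d b : ℕ} {Z : Type*} {f : Vec d → Z → ℝ} {X : Set (Vec d)} {L : ℝ}
    (hf : ∀ z, IsSmoothOn L X (fun x => f x z)) (zs : Fin b → Z)
    {x : Vec d} (hx : x ∈ X) :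
    gradient (empiricalRisk f zs) x = (1 / (b : ℝ)) • ∑ j, gradient (fun u => f u (zs j)) x := by
  refine HasGradientAt.gradient ?_
  rw [hasGradientAt_iff_hasFDerivAt, map_smul, map_sum]
  have h1 : ∀ j ∈ Finset.univ, HasFDerivAt (fun u => f u (zs j))
      (InnerProductSpace.toDual ℝ (Vec d) (gradient (fun u => f u (zs j)) x)) x := fun j _ =>
    hasGradientAt_iff_hasFDerivAt.1 ((hf (zs j)).1 x hx).hasGradientAt
  exact (HasFDerivAt.fun_sum h1).const_mul (1 / (b : ℝ))

/-! ### Robust means -/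

/-- If most of the values are within `r` of `y`, then so is the median, and the values that are
nearest to the median are within `3 r` of `y`. -/
theorem abs_sub_le_of_isMedian {k : ℕ} {v : Fin k → ℝ} {c y r α : ℝ} (hα : α < 1 / 2)
    (hk : 1 ≤ k) {G S : Finset (Fin k)} (hG : (1 - α) * k ≤ G.card) (hGv : ∀ i ∈ G, |v i - y| ≤ r)
    (hc : IsMedian v c) (hS : (S.card : ℝ) = (1 - α) * k)
    (hSn : ∀ i ∈ S, ∀ i' ∉ S, |v i - c| ≤ |v i' - c|) : ∀ i ∈ S, |v i - y| ≤ 3 * r := by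
  have hk' : (1 : ℝ) ≤ k := by exact_mod_cast hk
  -- As `G` contains more than half of the indices, it meets both halves that define the median,
  -- which is thus squeezed between two good values.
  have hlarge : ∀ A : Finset (Fin k), (k : ℝ) ≤ 2 * A.card → ∃ i ∈ G, i ∈ A := by
    intro A hA
    by_contra! hdis
    have h1 : Disjoint G A := Finset.disjoint_left.2 hdis
    have h2 : (G ∪ A).card ≤ k := by simpa using Finset.card_le_univ (G ∪ A)
    rw [Finset.card_union_of_disjoint h1] at h2
    have h3 : (G.card : ℝ) + A.card ≤ k := by exact_mod_cast h2
    nlinarith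
  have hcy : |c - y| ≤ r := by
    obtain ⟨i, hi, hic⟩ := hlarge _ (by exact_mod_cast hc.1)
    obtain ⟨j, hj, hjc⟩ := hlarge _ (by exact_mod_cast hc.2)
    have e1 := abs_le.1 (hGv i hi)
    have e2 := abs_le.1 (hGv j hj)
    have e3 := (Finset.mem_filter.1 hic).2
    have e4 := (Finset.mem_filter.1 hjc).2
    rw [abs_le]
    constructor <;> linarith
  intro i hi
  by_cases hiG : i ∈ G
  · have := hGv i hiG
    have := (abs_nonneg _).trans this
    linarith
  -- If a bad `i` is selected, `S` is too small to contain all of `G` as well. A good value left out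
  -- is at distance at most `2 r` from the median, and `i` is no farther.
  · have hSG : ¬ G ⊆ S := by
      intro hsub
      have h1 : (insert i G).card ≤ S.card :=
        Finset.card_le_card (Finset.insert_subset hi hsub)
      rw [Finset.card_insert_of_notMem hiG] at h1
      have h2 : (G.card : ℝ) + 1 ≤ S.card := by exact_mod_cast h1
      linarith
    obtain ⟨j, hjG, hjS⟩ := Finset.not_subset.1 hSG
    have e1 := abs_le.1 (hSn i hi j hjS)
    have e2 := abs_le.1 (hGv j hjG)
    have e3 := abs_le.1 hcy
    have e4 : |v j - c| ≤ 2 * r := by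
      rw [abs_le]; constructor <;> linarith
    rw [abs_le]
    constructor <;> linarith

/-- An average of values within `3 r` of `y`. This crude form serves the temporal means, where no
gain from averaging is needed. -/
theorem IsRobustMean.abs_sub_le {d k : ℕ} {α : ℝ} {v : Fin k → Vec d} {g : Vec d}
    (h : IsRobustMean α v g) (hα : α < 1 / 2) (hk : 1 ≤ k) {j : Fin d} {y r : ℝ}
    {G : Finset (Fin k)} (hG : (1 - α) * k ≤ G.card) (hGv : ∀ i ∈ G, |v i j - y| ≤ r) :
    |g j - y| ≤ 3 * r := by
  obtain ⟨c, hc, S, hS, hSn, hg⟩ := h j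
  have hS3 := abs_sub_le_of_isMedian hα hk hG hGv hc hS hSn
  have hk' : (1 : ℝ) ≤ k := by exact_mod_cast hk
  have hp : 0 < (1 - α) * k := by nlinarith
  have e : g j - y = (1 / ((1 - α) * k)) * ∑ i ∈ S, (v i j - y) := by
    rw [hg, Finset.sum_sub_distrib, Finset.sum_const, nsmul_eq_mul, hS, mul_sub, one_div,
      inv_mul_cancel_left₀ hp.ne']
  rw [e, abs_mul, abs_of_pos (by positivity), one_div_mul_eq_div, div_le_iff₀ hp, ← hS]
  calc _ ≤ ∑ i ∈ S, 3 * r :=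
        (Finset.abs_sum_le_sum_abs _ _).trans (Finset.sum_le_sum hS3)
    _ = _ := by rw [Finset.sum_const, nsmul_eq_mul]; ring

/-- The deviation of a robust mean from the mean of the good values. -/
theorem IsRobustMean.abs_sub_le_sum {d k : ℕ} {α : ℝ} {v : Fin k → Vec d} {g : Vec d}
    (h : IsRobustMean α v g) (hα : α < 1 / 2) (hk : 1 ≤ k) {j : Fin d} {y r : ℝ}
    {G : Finset (Fin k)} (hG : (1 - α) * k ≤ G.card) (hGv : ∀ i ∈ G, |v i j - y| ≤ r) (hr : 0 ≤ r) :
    |g j - y| ≤ 2 / k * |∑ i ∈ G, (v i j - y)| + 8 * α * r := by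
  classical
  obtain ⟨c, hc, S, hS, hSn, hg⟩ := h j
  have hS3 := abs_sub_le_of_isMedian hα hk hG hGv hc hS hSn
  have hk' : (1 : ℝ) ≤ k := by exact_mod_cast hk
  have hp : 0 < (1 - α) * k := by nlinarith
  have e : g j - y = (1 / ((1 - α) * k)) * ∑ i ∈ S, (v i j - y) := by
    rw [hg, Finset.sum_sub_distrib, Finset.sum_const, nsmul_eq_mul, hS, mul_sub, one_div,
      inv_mul_cancel_left₀ hp.ne']
  have hcompl : ∀ A B : Finset (Fin k), (1 - α) * k ≤ B.card → ((A \ B).card : ℝ) ≤ α * k := by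
    intro A B hB
    have h1 : (A \ B).card + B.card ≤ k := by
      rw [← Finset.card_union_of_disjoint Finset.sdiff_disjoint]
      simpa using Finset.card_le_univ (A \ B ∪ B)
    have h2 : ((A \ B).card : ℝ) + B.card ≤ k := by exact_mod_cast h1
    linarith
  -- Keeping the signed sum over `G` preserves cancellation. Each correction has at most `α k`
  -- terms, of size `r` for discarded good values and `3 r` for retained bad ones; `1 - α ≥ 1/2`
  -- then gives the factors `2 / k` and `8 α`.
  have hsum : ∑ i ∈ S, (v i j - y) = ∑ i ∈ G, (v i j - y) - ∑ i ∈ G \ S, (v i j - y) +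
      ∑ i ∈ S \ G, (v i j - y) := by
    have h1 := Finset.sum_inter_add_sum_sdiff S G fun i => v i j - y
    have h2 := Finset.sum_inter_add_sum_sdiff G S fun i => v i j - y
    rw [Finset.inter_comm] at h2
    linarith
  have hb : ∀ (A : Finset (Fin k)) (c : ℝ), 0 ≤ c → (∀ i ∈ A, |v i j - y| ≤ c) →
      (A.card : ℝ) ≤ α * k → |∑ i ∈ A, (v i j - y)| ≤ α * k * c := by
    intro A c hc hA hAc
    calc _ ≤ ∑ i ∈ A, c := (Finset.abs_sum_le_sum_abs _ _).trans (Finset.sum_le_sum hA)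
      _ = A.card * c := by rw [Finset.sum_const, nsmul_eq_mul]
      _ ≤ _ := by gcongr
  have h1 := hb (G \ S) r hr (fun i hi => hGv i (Finset.mem_sdiff.1 hi).1) (hcompl G S hS.ge)
  have h2 := hb (S \ G) (3 * r) (by linarith) (fun i hi => hS3 i (Finset.mem_sdiff.1 hi).1)
    (hcompl S G hG)
  have hαr : 0 ≤ α * k * r := (abs_nonneg _).trans h1
  have h3 : |∑ i ∈ S, (v i j - y)| ≤ |∑ i ∈ G, (v i j - y)| + 4 * (α * k * r) := by
    rw [hsum]
    refine (abs_add_le _ _).trans ?_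
    have := abs_sub (∑ i ∈ G, (v i j - y)) (∑ i ∈ G \ S, (v i j - y))
    linarith
  rw [e, abs_mul, abs_of_pos (by positivity)]
  calc _ ≤ (2 / k) * (|∑ i ∈ G, (v i j - y)| + 4 * (α * k * r)) := by
        refine mul_le_mul ?_ h3 (abs_nonneg _) (by positivity)
        rw [div_le_div_iff₀ hp (by linarith)]
        nlinarith
    _ = _ := by field_simp; ring

/-! ### The agents' Markov chains -/

section Chain

variable {N : ℕ} {Ω : Type*} {mΩ : MeasurableSpace Ω} {P : Measure Ω} [IsProbabilityMeasure P]
  {ℱ : Filtration ℕ mΩ} {pb pt : ℝ} {W : ℕ → Ω → Config N}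

theorem jointTransition_nonneg (h0 : 0 ≤ pb) (h1 : pb ≤ 1) (h2 : 0 ≤ pt) (h3 : pt ≤ 1)
    (w w' : Config N) : 0 ≤ jointTransition pb pt w w' := by
  refine Finset.prod_nonneg fun i _ => ?_
  unfold transitionMatrix
  generalize w i = p
  generalize w' i = q
  fin_cases p <;> fin_cases q <;> simp <;> linarith

theorem pathProb_nonneg (h0 : 0 ≤ pb) (h1 : pb ≤ 1) (h2 : 0 ≤ pt) (h3 : pt ≤ 1) {n : ℕ}
    (w : Config N) (p : Fin n → Config N) : 0 ≤ pathProb pb pt w p := by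
  unfold pathProb
  refine mul_nonneg (by split_ifs <;> norm_num) (Finset.prod_nonneg fun k _ => ?_)
  split_ifs
  · exact jointTransition_nonneg h0 h1 h2 h3 _ _
  · norm_num

theorem failureProb_nonneg (h0 : 0 ≤ pb) (h1 : pb ≤ 1) (h2 : 0 ≤ pt) (h3 : pt ≤ 1)
    (m₀ m N : ℕ) (α₁ α₂ : ℝ) : 0 ≤ failureProb m₀ m N α₁ α₂ pb pt := by
  refine Real.iSup_nonneg fun w => Finset.sum_nonneg fun p _ => ?_
  exact mul_nonneg (pathProb_nonneg h0 h1 h2 h3 _ _) (by split_ifs <;> norm_num)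

theorem measurableSet_state (hW : Adapted ℱ W) (t : ℕ) (w : Config N) :
    MeasurableSet[ℱ t] {ω | W t ω = w} :=
  hW t (measurableSet_singleton w)

open Classical in
/-- One step of the chain: integrate a bounded function of the past over `W (t + 1) = w`. -/
theorem IsAgentChain.integral_step (hW : IsAgentChain P ℱ pb pt W) {t : ℕ} (ht : 1 ≤ t)
    {ψ : Ω → ℝ} (hψ : Measurable[ℱ t] ψ) {c : ℝ} (hc : ∀ ω, |ψ ω| ≤ c) (w : Config N) :
    ∫ ω, ψ ω * (if W (t + 1) ω = w then 1 else 0) ∂P =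
      ∫ ω, ψ ω * jointTransition pb pt (W t ω) w ∂P := by
  have hm : MeasurableSet {ω | W (t + 1) ω = w} :=
    ℱ.le (t + 1) _ (measurableSet_state hW.1 (t + 1) w)
  set g : Ω → ℝ := Set.indicator {ω | W (t + 1) ω = w} fun _ => (1 : ℝ) with hg
  have hgi : Integrable g P := (integrable_const _).indicator hm
  have h1 := condExp_stronglyMeasurable_mul_of_bound (ℱ.le t) hψ.stronglyMeasurable hgi c
    (Filter.Eventually.of_forall hc)
  have e : (fun ω => ψ ω * (if W (t + 1) ω = w then 1 else 0)) = ψ * g := by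
    funext ω
    simp only [hg, Pi.mul_apply, Set.indicator_apply, Set.mem_ofPred_eq]
  rw [e]
  have h2 := integral_condExp (ℱ.le t) (μ := P) (f := ψ * g)
  rw [← h2]
  refine integral_congr_ae ?_
  filter_upwards [h1, hW.2 t ht w] with ω h3 h4
  rw [h3, Pi.mul_apply, h4]

open Classical in
/-- The law of `n + 1` consecutive configurations, given the past of the first one. -/
theorem IsAgentChain.integral_path (hW : IsAgentChain P ℱ pb pt W) {s : ℕ} (hs : 1 ≤ s)
    {φ : Ω → ℝ} (hφ : Measurable[ℱ s] φ) {c : ℝ} (hc : ∀ ω, |φ ω| ≤ c) (q : ℕ → Config N) (n : ℕ) :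
    ∫ ω, φ ω * (if ∀ k ≤ n, W (s + k) ω = q k then 1 else 0) ∂P =
      (∫ ω, φ ω * (if W s ω = q 0 then 1 else 0) ∂P) *
        ∏ k ∈ Finset.range n, jointTransition pb pt (q k) (q (k + 1)) := by
  induction n with
  | zero => simp
  | succ n ih =>
    rw [Finset.prod_range_succ, ← mul_assoc, ← ih]
    set ψ : Ω → ℝ := fun ω => φ ω * (if ∀ k ≤ n, W (s + k) ω = q k then 1 else 0) with hψ
    have hψm : Measurable[ℱ (s + n)] ψ := by
      refine Measurable.mul (hφ.mono (ℱ.mono (by omega)) le_rfl) ?_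
      refine Measurable.ite ?_ measurable_const measurable_const
      have : {ω | ∀ k ≤ n, W (s + k) ω = q k} = ⋂ k ∈ Finset.range (n + 1),
          {ω | W (s + k) ω = q k} := by
        ext ω; simp
      rw [this]
      refine Finset.measurableSet_biInter _ fun k hk => ?_
      exact ℱ.mono (by have := Finset.mem_range.1 hk; omega) _ (measurableSet_state hW.1 _ _)
    have hψc : ∀ ω, |ψ ω| ≤ c := by
      intro ω
      simp only [hψ]
      split_ifs
      · simpa using hc ω
      · simpa using (abs_nonneg _).trans (hc ω)
    have hstep := hW.integral_step (t := s + n) (by omega) hψm hψc (q (n + 1))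
    have e1 : ∀ ω, φ ω * (if ∀ k ≤ n + 1, W (s + k) ω = q k then (1 : ℝ) else 0) =
        ψ ω * (if W (s + n + 1) ω = q (n + 1) then 1 else 0) := by
      intro ω
      have : (∀ k ≤ n + 1, W (s + k) ω = q k) ↔
          (∀ k ≤ n, W (s + k) ω = q k) ∧ W (s + n + 1) ω = q (n + 1) := by
        constructor
        · exact fun h => ⟨fun k hk => h k (by omega), h (n + 1) le_rfl⟩
        · rintro ⟨h1, h2⟩ k hk
          rcases Nat.lt_or_ge k (n + 1) with h | h
          · exact h1 k (by omega)
          · obtain rfl : k = n + 1 := by omega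
            exact h2
      simp only [hψ, this]
      split_ifs <;> simp_all
    have e2 : ∀ ω, ψ ω * jointTransition pb pt (W (s + n) ω) (q (n + 1)) =
        ψ ω * jointTransition pb pt (q n) (q (n + 1)) := by
      intro ω
      simp only [hψ]
      split_ifs with h
      · rw [h n le_rfl]
      · simp
    simp_rw [e1]
    rw [hstep]
    simp_rw [e2]
    rw [integral_mul_const]

open Classical in
/-- The law of `n + 1` consecutive configurations in terms of `pathProb`. -/
theorem IsAgentChain.integral_pathProb (hW : IsAgentChain P ℱ pb pt W) {s : ℕ} (hs : 1 ≤ s)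
    {φ : Ω → ℝ} (hφ : Measurable[ℱ s] φ) {c : ℝ} (hc : ∀ ω, |φ ω| ≤ c) {n : ℕ} (hn : 1 ≤ n)
    (p : Fin n → Config N) :
    ∫ ω, φ ω * (if (fun k : Fin n => W (s + k) ω) = p then 1 else 0) ∂P =
      ∫ ω, φ ω * pathProb pb pt (W s ω) p ∂P := by
  obtain ⟨n, rfl⟩ : ∃ k, n = k + 1 := ⟨n - 1, by omega⟩
  set q : ℕ → Config N := fun k => if h : k < n + 1 then p ⟨k, h⟩ else p 0 with hq
  have hqp : ∀ k (h : k < n + 1), q k = p ⟨k, h⟩ := fun k h => dif_pos h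
  have e1 : ∀ ω, ((fun k : Fin (n + 1) => W (s + k) ω) = p) ↔ ∀ k ≤ n, W (s + k) ω = q k := by
    intro ω
    rw [funext_iff]
    constructor
    · intro h k hk
      rw [hqp k (by omega)]
      exact h ⟨k, by omega⟩
    · intro h k
      rw [h k (by omega), hqp k k.2]
  have e2 : ∀ ω, pathProb pb pt (W s ω) p = (if W s ω = q 0 then 1 else 0) *
      ∏ k ∈ Finset.range n, jointTransition pb pt (q k) (q (k + 1)) := by
    intro ω
    unfold pathProb
    congr 1
    · have : (∀ h : 0 < n + 1, p ⟨0, h⟩ = W s ω) ↔ W s ω = q 0 := by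
        rw [hqp 0 (by omega)]
        exact ⟨fun h => (h (by omega)).symm, fun h _ => h.symm⟩
      simp only [this]
    · rw [Fin.prod_univ_castSucc, ← Fin.prod_univ_eq_prod_range
        (fun k => jointTransition pb pt (q k) (q (k + 1)))]
      simp only [Fin.val_last, lt_irrefl, dite_false, mul_one]
      refine Finset.prod_congr rfl fun k _ => ?_
      rw [dif_pos (by simp), hqp k (by omega), hqp (k + 1) (by omega)]
      rfl
  simp only [e1, e2]
  rw [hW.integral_path hs hφ hc q n, ← integral_mul_const]
  simp only [mul_assoc]

open Classical in
/-- The probability of a failure at `t = s + m₀ + m - 1`, given the past up to `s`. -/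
theorem IsAgentChain.integral_windowFails_le (hW : IsAgentChain P ℱ pb pt W) {s : ℕ} (hs : 1 ≤ s)
    {φ : Ω → ℝ} (hφ : Measurable[ℱ s] φ) {c : ℝ} (hc : ∀ ω, |φ ω| ≤ c) (h0 : ∀ ω, 0 ≤ φ ω)
    {m₀ m : ℕ} (hm : 1 ≤ m) (α₁ α₂ : ℝ) :
    ∫ ω, φ ω * (if WindowFails α₁ α₂ (fun τ : Fin m => W (s + (m₀ + τ)) ω) then 1 else 0) ∂P ≤
      failureProb m₀ m N α₁ α₂ pb pt * ∫ ω, φ ω ∂P := by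
  have hφi : Integrable φ P := (integrable_const c).mono'
    (hφ.mono (ℱ.le s) le_rfl).aestronglyMeasurable (Filter.Eventually.of_forall hc)
  have hWm : ∀ t, Measurable (W t) := fun t => (hW.1 t).mono (ℱ.le t) le_rfl
  have hpath : Measurable fun ω => fun k : Fin (m₀ + m) => W (s + k) ω :=
    measurable_pi_lambda _ fun k => hWm _
  have hbdd : ∀ {g : Ω → ℝ} {C : ℝ}, Measurable g → (∀ ω, |g ω| ≤ C) →
      Integrable (fun ω => φ ω * g ω) P := fun {g C} hg hC =>
    hφi.mul_bdd (c := C) hg.aestronglyMeasurable (Filter.Eventually.of_forall hC)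
  set F : (Fin (m₀ + m) → Config N) → ℝ := fun p =>
    if WindowFails α₁ α₂ (fun τ : Fin m => p (Fin.natAdd m₀ τ)) then 1 else 0 with hF
  -- Split over all paths of length `m₀ + m` from time `s`; the window is formed by the last `m`
  -- entries.
  have e1 : ∀ ω, φ ω * (if WindowFails α₁ α₂ (fun τ : Fin m => W (s + (m₀ + τ)) ω) then 1 else 0) =
      ∑ p, φ ω * (if (fun k : Fin (m₀ + m) => W (s + k) ω) = p then 1 else 0) * F p := by
    intro ω
    simp only [mul_ite, mul_one, mul_zero, ite_mul, zero_mul, Finset.sum_ite_eq, Finset.mem_univ,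
      if_true]
    simp only [hF, Fin.val_natAdd, mul_ite, mul_one, mul_zero]
  have hint : ∀ p : Fin (m₀ + m) → Config N, Integrable (fun ω => φ ω *
      (if (fun k : Fin (m₀ + m) => W (s + k) ω) = p then (1 : ℝ) else 0)) P := by
    intro p
    refine hbdd (C := 1) (Measurable.ite (hpath (measurableSet_singleton p)) measurable_const
      measurable_const) fun ω => ?_
    split_ifs <;> simp
  have hmW : ∀ G : Config N → ℝ, Integrable (fun ω => φ ω * G (W s ω)) P := by
    intro G
    refine hbdd (C := ∑ w, |G w|) ((measurable_of_countable G).comp (hWm s)) fun ω => ?_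
    exact Finset.single_le_sum (f := fun w => |G w|) (fun _ _ => abs_nonneg _) (Finset.mem_univ _)
  simp_rw [e1]
  rw [integral_finsetSum _ fun p _ => (hint p).mul_const _]
  simp_rw [integral_mul_const, hW.integral_pathProb hs hφ hc (show 1 ≤ m₀ + m by omega),
    ← integral_mul_const]
  rw [← integral_finsetSum _ fun p _ => (hmW fun w => pathProb pb pt w p).mul_const _,
    ← integral_const_mul]
  have e2 : ∀ ω, ∑ p, φ ω * pathProb pb pt (W s ω) p * F p =
      φ ω * failureProbFrom m₀ m N α₁ α₂ pb pt (W s ω) := by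
    intro ω
    simp only [failureProbFrom, Finset.mul_sum, mul_assoc, hF]
  simp_rw [e2]
  refine integral_mono (hmW _) (hφi.const_mul _) fun ω => ?_
  show φ ω * _ ≤ _ * φ ω
  rw [mul_comm]
  exact mul_le_mul_of_nonneg_right (le_ciSup (f := failureProbFrom m₀ m N α₁ α₂ pb pt)
    (Set.finite_range _).bddAbove _) (h0 ω)

end Chain

/-! ### One iteration -/

section Step

variable {d : ℕ}

theorem IsProjection.norm_sub_le {X : Set (Vec d)} (hX : Convex ℝ X) {y p q : Vec d}
    (h : IsProjection X y p) (hq : q ∈ X) : ‖p - q‖ ≤ ‖y - q‖ := by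
  have : Nonempty X := ⟨⟨p, h.1⟩⟩
  have hinf : ‖y - p‖ = ⨅ w : X, ‖y - w‖ :=
    le_antisymm (le_ciInf fun w => h.2 w w.2)
      (ciInf_le (f := fun w : X => ‖y - w‖) ⟨0, by rintro _ ⟨w, rfl⟩; exact norm_nonneg _⟩ ⟨p, h.1⟩)
  have hin := (norm_eq_iInf_iff_real_inner_le_zero hX h.1).1 hinf q hq
  have e : ‖y - q‖ ^ 2 = ‖y - p‖ ^ 2 - 2 * inner ℝ (y - p) (q - p) + ‖p - q‖ ^ 2 := by
    rw [show y - q = (y - p) - (q - p) by abel, norm_sub_sq_real, norm_sub_rev q p]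
  refine le_of_sq_le_sq ?_ (norm_nonneg _)
  nlinarith [sq_nonneg ‖y - p‖]

theorem norm_normalize_le (g : Vec d) : ‖‖g‖⁻¹ • g‖ ≤ 1 := by
  rw [norm_smul, norm_inv, norm_norm]
  exact inv_mul_le_one

/-- The normalized step direction makes progress up to the error of the aggregate. -/
theorem le_inner_normalize {g G v : Vec d} {μ L e : ℝ} (hμ : 0 < μ) (hμL : μ ≤ L)
    (hg : ‖g - G‖ ≤ e) (hG : ‖G‖ ≤ L * ‖v‖) (hGv : μ * ‖v‖ ^ 2 ≤ inner ℝ G v) :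
    μ / L * ‖v‖ - (1 + μ / L) * (e / μ) ≤ inner ℝ (‖g‖⁻¹ • g) v := by
  have hL : 0 < L := hμ.trans_le hμL
  have he : 0 ≤ e := (norm_nonneg _).trans hg
  have hv := norm_nonneg v
  have h1 : ‖v‖ * (μ * ‖v‖ - e) ≤ inner ℝ g v := by
    have e1 : inner ℝ g v = inner ℝ (g - G) v + inner ℝ G v := by rw [← inner_add_left]; simp
    have e2 := (abs_le.1 (abs_real_inner_le_norm (g - G) v)).1
    have e3 := mul_le_mul_of_nonneg_right hg hv
    nlinarith
  have h2 : ‖g‖ ≤ L * ‖v‖ + e := by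
    calc ‖g‖ = ‖(g - G) + G‖ := by simp
      _ ≤ _ := (norm_add_le _ _).trans (by linarith)
  set r := μ / L with hr
  have hrL : r * L = μ := by rw [hr]; field_simp
  have hr0 : 0 < r := by positivity
  have hr1 : r ≤ 1 := (div_le_one hL).2 hμL
  have hem : e / μ * μ = e := by field_simp
  set w := e / μ with hw
  have hw0 : 0 ≤ w := by positivity
  rw [inner_smul_left]
  simp only [conj_trivial]
  rcases (norm_nonneg g).eq_or_lt with h0 | h0
  · rw [← h0]
    have hgz : g = 0 := norm_eq_zero.1 h0.symm
    rw [hgz, inner_zero_left] at h1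
    have : ‖v‖ ≤ w := by
      by_contra! hlt
      have : e < μ * ‖v‖ := by rw [← hem]; nlinarith
      nlinarith
    simp only [inv_zero, zero_mul]
    nlinarith
  · rw [← div_eq_inv_mul, le_div_iff₀ h0]
    -- If `‖v‖` is at least `w = e / μ`, strong monotonicity makes the inner product nonnegative and
    -- the bound on `‖g‖` can be divided out. Otherwise Cauchy–Schwarz gives `-‖v‖`, which already
    -- exceeds the claimed bound.
    rcases le_or_gt w ‖v‖ with hc | hc
    · rcases le_or_gt (r * ‖v‖ - (1 + r) * w) 0 with hs | hs
      · have : 0 ≤ ‖v‖ * (μ * ‖v‖ - e) := mul_nonneg hv (by rw [← hem]; nlinarith)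
        nlinarith
      · have e1 : (r * ‖v‖ - (1 + r) * w) * ‖g‖ ≤ (r * ‖v‖ - (1 + r) * w) * (L * ‖v‖ + e) :=
          mul_le_mul_of_nonneg_left h2 hs.le
        refine e1.trans (le_trans ?_ h1)
        have e2 : e = r * L * w := by rw [hrL, ← hem]; ring
        rw [e2, ← hrL]
        have p1 : 0 ≤ L * (‖v‖ * w) := by positivity
        have p2 : 0 ≤ L * (w * w) := by positivity
        have p3 := mul_nonneg hr0.le p2
        have p4 := mul_nonneg hr0.le p3
        have p5 := mul_nonneg (sub_nonneg.2 hr1) p1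
        have p6 := mul_nonneg (mul_nonneg hr0.le (sub_nonneg.2 hr1)) p1
        nlinarith
    · have e1 := (abs_le.1 (abs_real_inner_le_norm g v)).1
      have : r * ‖v‖ - (1 + r) * w ≤ -‖v‖ := by nlinarith
      nlinarith

/-- Projecting does not increase the distance to `xs`, and normalization leaves only `γ ^ 2` as
second-order term, with no bound on the aggregate. -/
theorem norm_sub_sq_step_le {X : Set (Vec d)} (hX : Convex ℝ X) {x x' xs g : Vec d} {γ : ℝ}
    (hγ : 0 ≤ γ) (hxs : xs ∈ X) (h : IsProjection X (x - γ • (‖g‖⁻¹ • g)) x') :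
    ‖x' - xs‖ ^ 2 ≤ ‖x - xs‖ ^ 2 - 2 * γ * inner ℝ (‖g‖⁻¹ • g) (x - xs) + γ ^ 2 := by
  have h1 := pow_le_pow_left₀ (norm_nonneg _) (h.norm_sub_le hX hxs) 2
  refine h1.trans ?_
  rw [show x - γ • (‖g‖⁻¹ • g) - xs = (x - xs) - γ • (‖g‖⁻¹ • g) by abel, norm_sub_sq_real,
    inner_smul_right, norm_smul, real_inner_comm, Real.norm_eq_abs, abs_of_nonneg hγ]
  have h2 : (γ * ‖‖g‖⁻¹ • g‖) ^ 2 ≤ γ ^ 2 := by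
    refine pow_le_pow_left₀ (by positivity) ?_ 2
    exact mul_le_of_le_one_right hγ (norm_normalize_le g)
  linarith

end Step

/-! ### Pathwise analysis of a run -/

section Run

variable {d N : ℕ} {X : Set (Vec d)} {localGrad : Fin N → Vec d → Vec d} {m K : ℕ} {α₁ α₂ γ : ℝ}
  {W : ℕ → Config N} {x₁ : Vec d} {x : ℕ → Vec d}

theorem IsRangeRun.mem (h : IsRangeRun X localGrad m α₁ α₂ γ K W x₁ x) (hx₁ : x₁ ∈ X) {t : ℕ}
    (ht : 1 ≤ t) (htK : t ≤ K + 1) : x t ∈ X := by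
  obtain ⟨h1, g, gh, gg, hrun⟩ := h
  obtain ⟨t, rfl⟩ : ∃ k, t = k + 1 := ⟨t - 1, by omega⟩
  rcases Nat.eq_zero_or_pos t with rfl | ht0
  · rw [zero_add, h1]; exact hx₁
  · exact (hrun t ht0 (by omega)).2.2.2.2.1

/-- A previous iterate lies in `X`, so projecting cannot lengthen a step of norm at most `γ`. This
holds for arbitrary Byzantine feedback. -/
theorem IsRangeRun.norm_sub_le (h : IsRangeRun X localGrad m α₁ α₂ γ K W x₁ x) (hx₁ : x₁ ∈ X)
    (hX : Convex ℝ X) (hγ : 0 ≤ γ) {s : ℕ} (hs : 1 ≤ s) (n : ℕ) (hK : s + n ≤ K + 1) :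
    ‖x (s + n) - x s‖ ≤ γ * n := by
  induction n with
  | zero => simp
  | succ n ih =>
    have ih := ih (by omega)
    have hmem := h.mem hx₁ (t := s + n) (by omega) (by omega)
    obtain ⟨h1, g, gh, gg, hrun⟩ := h
    have hp := (hrun (s + n) (by omega) (by omega)).2.2.2.2
    have h2 := hp.norm_sub_le hX hmem
    have h3 : ‖x (s + n) - γ • (‖gg (s + n)‖⁻¹ • gg (s + n)) - x (s + n)‖ ≤ γ := by
      rw [sub_sub_cancel_left, norm_neg, norm_smul, Real.norm_eq_abs, abs_of_nonneg hγ]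
      exact mul_le_of_le_one_right hγ (norm_normalize_le _)
    calc ‖x (s + (n + 1)) - x s‖ = ‖(x (s + n + 1) - x (s + n)) + (x (s + n) - x s)‖ := by
          rw [sub_add_sub_cancel]; rfl
      _ ≤ _ := norm_add_le _ _
      _ ≤ γ * (n + 1 : ℕ) := by push_cast; linarith

open Classical in
/-- Outside of the failure event, the aggregate is close to the gradient of the expected cost. -/
theorem norm_aggregate_sub_le {g gh : ℕ → Fin N → Vec d} {gg : ℕ → Vec d} {t : ℕ}
    {gF : Vec d → Vec d} {L H Hb : ℝ} (hN : 1 ≤ N) (hm : 1 ≤ m) (hmt : m ≤ t) (hγ : 0 ≤ γ)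
    (hL : 0 ≤ L) (hα₁ : α₁ < 1 / 2) (hα₂ : α₂ < 1 / 2) (hα₂0 : 0 ≤ α₂)
    (hmem : ∀ s, 1 ≤ s → s ≤ t → x s ∈ X)
    (hdist : ∀ s n, 1 ≤ s → s + n = t → ‖x t - x s‖ ≤ γ * n)
    (hg : ∀ s, 1 ≤ s → s ≤ t → ∀ i, W s i = 0 → g s i = localGrad i (x s))
    (hgh : ∀ i, IsRobustMean α₁ (fun τ : Fin m => g (t - τ) i) (gh t i))
    (hgg : IsRobustMean α₂ (gh t) (gg t))
    (hlip : ∀ i, ∀ y ∈ X, ∀ z ∈ X, ‖localGrad i y - localGrad i z‖ ≤ L * ‖y - z‖)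
    (hH : ∀ i, ∀ y ∈ X, ∀ j, |localGrad i y j - gF y j| ≤ H)
    (hHb : ∀ y ∈ X, ∀ j, |1 / (N : ℝ) * ∑ i, (localGrad i y j - gF y j)| ≤ Hb)
    (hW : ¬ WindowFails α₁ α₂ (fun τ : Fin m => W (t - m + 1 + τ))) :
    ‖gg t - gF (x t)‖ ≤ √d * (2 * Hb + 10 * α₂ * H + 18 * (L * (γ * (m - 1)))) := by
  have hN1 : (1 : ℝ) ≤ N := by exact_mod_cast hN
  have hm1 : (1 : ℝ) ≤ m := by exact_mod_cast hm
  have hxt := hmem t (by omega) le_rfl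
  set r := L * (γ * ((m : ℝ) - 1)) with hr
  have hr0 : 0 ≤ r := mul_nonneg hL (mul_nonneg hγ (by linarith))
  set G : Finset (Fin N) :=
    Finset.univ.filter fun i => ¬ α₁ * m < ((∑ τ : Fin m, (W (t - m + 1 + τ) i : ℕ) : ℕ) : ℝ) with hG
  have hGc : ((Gᶜ).card : ℝ) ≤ α₂ * N := by
    rw [WindowFails, not_lt] at hW
    have e : Gᶜ = Finset.univ.filter fun i : Fin N =>
        α₁ * m < ((∑ τ : Fin m, (W (t - m + 1 + τ) i : ℕ) : ℕ) : ℝ) := by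
      ext i
      rw [Finset.mem_compl, hG, Finset.mem_filter, Finset.mem_filter]
      simp only [Finset.mem_univ, true_and, not_not]
    rw [e]
    exact hW
  have hGcard : (1 - α₂) * N ≤ (G.card : ℝ) := by
    have h1 := Finset.card_add_card_compl G
    rw [Fintype.card_fin] at h1
    have h2 : (G.card : ℝ) + (Gᶜ).card = N := by exact_mod_cast h1
    linarith
  -- temporal robustification
  have htemp : ∀ i ∈ G, ∀ j, |gh t i j - localGrad i (x t) j| ≤ 3 * r := by
    intro i hi j
    have hi' := (Finset.mem_filter.1 hi).2
    rw [not_lt] at hi'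
    set A : Finset (Fin m) := Finset.univ.filter fun τ : Fin m => W (t - τ) i = 0 with hA
    refine (hgh i).abs_sub_le hα₁ hm (G := A) ?_ ?_
    · have h1 : (∑ τ : Fin m, (W (t - m + 1 + τ) i : ℕ)) = ∑ τ : Fin m, (W (t - τ) i : ℕ) := by
        -- The failure event reads the window forwards in time, the robust mean backwards.
        rw [← Equiv.sum_comp Fin.revPerm]
        refine Finset.sum_congr rfl fun τ _ => ?_
        rw [Fin.revPerm_apply, Fin.val_rev]
        congr 3
        omega
      have h2 : (Aᶜ).card ≤ ∑ τ : Fin m, (W (t - τ) i : ℕ) := by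
        rw [Finset.card_eq_sum_ones]
        refine le_trans (Finset.sum_le_sum (g := fun τ : Fin m => (W (t - τ) i : ℕ)) fun τ hτ => ?_)
          (Finset.sum_le_sum_of_subset (Finset.subset_univ _))
        simp only [hA, Finset.mem_compl, Finset.mem_filter, Finset.mem_univ, true_and] at hτ
        exact Nat.one_le_iff_ne_zero.2 fun h0 => hτ (Fin.ext h0)
      rw [h1] at hi'
      have h3 := Finset.card_add_card_compl A
      rw [Fintype.card_fin] at h3
      have h4 : (A.card : ℝ) + (Aᶜ).card = m := by exact_mod_cast h3
      have h5 : ((Aᶜ).card : ℝ) ≤ ((∑ τ : Fin m, (W (t - τ) i : ℕ) : ℕ) : ℝ) := by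
        exact_mod_cast h2
      linarith
    · intro τ hτ
      have hτ0 := (Finset.mem_filter.1 hτ).2
      have hτm := τ.2
      have hs1 : 1 ≤ t - (τ : ℕ) := by omega
      rw [hg _ hs1 (by omega) i hτ0, ← PiLp.sub_apply]
      refine (abs_apply_le_norm _ j).trans ((hlip i _ (hmem _ hs1 (by omega)) _ hxt).trans ?_)
      refine mul_le_mul_of_nonneg_left ?_ hL
      rw [norm_sub_rev]
      refine (hdist (t - τ) τ hs1 (by omega)).trans (mul_le_mul_of_nonneg_left ?_ hγ)
      have : ((τ : ℕ) : ℝ) + 1 ≤ m := by exact_mod_cast hτm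
      linarith
  have hHb0 : ∀ j : Fin d, 0 ≤ Hb := fun j => (abs_nonneg _).trans (hHb _ hxt j)
  have hH0 : ∀ j : Fin d, 0 ≤ H := fun j => (abs_nonneg _).trans (hH ⟨0, hN⟩ _ hxt j)
  rcases isEmpty_or_nonempty (Fin d) with hd | ⟨⟨j₀⟩⟩
  · have : gg t - gF (x t) = 0 := by ext j; exact hd.elim j
    rw [this, norm_zero]
    have : d = 0 := Nat.eq_zero_of_not_pos fun h => hd.elim ⟨0, h⟩
    subst this
    simp
  have hp0 := hHb0 j₀
  have hp1 := hH0 j₀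
  refine norm_le_sqrt_mul (by positivity) fun j => ?_
  have hdev : ∀ i ∈ G, |gh t i j - gF (x t) j| ≤ H + 3 * r := by
    intro i hi
    have e1 := abs_le.1 (htemp i hi j)
    have e2 := abs_le.1 (hH i _ hxt j)
    rw [abs_le]
    constructor <;> linarith
  have h1 := hgg.abs_sub_le_sum hα₂ hN hGcard hdev (by linarith)
  have hsum : |∑ i ∈ G, (gh t i j - gF (x t) j)| ≤ N * Hb + α₂ * N * H + N * (3 * r) := by
    -- `G` depends on the random states, so its sum is compared with the sum over all agents, which
    -- `Hb` controls. The at most `α₂ N` agents outside `G` contribute `H` each: their empirical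
    -- gradients exist even if never sent.
    have e1 : ∑ i ∈ G, (gh t i j - gF (x t) j) = ∑ i, (localGrad i (x t) j - gF (x t) j) -
        ∑ i ∈ Gᶜ, (localGrad i (x t) j - gF (x t) j) +
          ∑ i ∈ G, (gh t i j - localGrad i (x t) j) := by
      rw [← Finset.sum_add_sum_compl G, add_sub_cancel_right, ← Finset.sum_add_distrib]
      exact Finset.sum_congr rfl fun i _ => by ring
    have e2 : |∑ i, (localGrad i (x t) j - gF (x t) j)| ≤ N * Hb := by
      have := hHb _ hxt j
      rw [abs_mul, abs_of_pos (by positivity), one_div_mul_eq_div, div_le_iff₀ (by linarith)] at this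
      linarith
    have e3 : |∑ i ∈ Gᶜ, (localGrad i (x t) j - gF (x t) j)| ≤ α₂ * N * H := by
      calc _ ≤ ∑ i ∈ Gᶜ, H := (Finset.abs_sum_le_sum_abs _ _).trans
              (Finset.sum_le_sum fun i _ => hH i _ hxt j)
        _ = (Gᶜ).card * H := by rw [Finset.sum_const, nsmul_eq_mul]
        _ ≤ _ := by gcongr
    have e4 : |∑ i ∈ G, (gh t i j - localGrad i (x t) j)| ≤ N * (3 * r) := by
      calc _ ≤ ∑ i ∈ G, 3 * r := (Finset.abs_sum_le_sum_abs _ _).trans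
              (Finset.sum_le_sum fun i hi => htemp i hi j)
        _ = G.card * (3 * r) := by rw [Finset.sum_const, nsmul_eq_mul]
        _ ≤ _ := by
          have : G.card ≤ N := by simpa using Finset.card_le_univ G
          gcongr
    rw [e1, abs_le]
    rw [abs_le] at e2 e3 e4
    constructor <;> linarith
  rw [PiLp.sub_apply]
  refine h1.trans ?_
  have h2 : 2 / (N : ℝ) * |∑ i ∈ G, (gh t i j - gF (x t) j)| ≤
      2 / N * (N * Hb + α₂ * N * H + N * (3 * r)) := by gcongr
  have h3 : 2 / (N : ℝ) * (N * Hb + α₂ * N * H + N * (3 * r)) = 2 * Hb + 2 * α₂ * H + 6 * r := by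
    field_simp; ring
  -- The drift enters as `6 r` from the sum and `24 α₂ r ≤ 12 r` from trimming, together `18 r`; the
  -- noise as `(2 + 8) α₂ H`.
  nlinarith [mul_nonneg (sub_nonneg.2 hα₂.le) hr0]

open Classical in
/-- One iteration, from the first full window on. -/
theorem IsRangeRun.norm_sub_sq_le (h : IsRangeRun X localGrad m α₁ α₂ γ K W x₁ x) (hx₁ : x₁ ∈ X)
    (hX : Convex ℝ X) (hγ : 0 ≤ γ) {gF : Vec d → Vec d} {L μ H Hb : ℝ} {xs : Vec d} (hxs : xs ∈ X)
    (hN : 1 ≤ N) (hm : 1 ≤ m) (hμ : 0 < μ) (hμL : μ ≤ L) (hα₁ : α₁ < 1 / 2) (hα₂ : α₂ < 1 / 2)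
    (hα₂0 : 0 ≤ α₂)
    (hlip : ∀ i, ∀ y ∈ X, ∀ z ∈ X, ‖localGrad i y - localGrad i z‖ ≤ L * ‖y - z‖)
    (hH : ∀ i, ∀ y ∈ X, ∀ j, |localGrad i y j - gF y j| ≤ H)
    (hHb : ∀ y ∈ X, ∀ j, |1 / (N : ℝ) * ∑ i, (localGrad i y j - gF y j)| ≤ Hb)
    (hF : ∀ y ∈ X, ‖gF y‖ ≤ L * ‖y - xs‖)
    (hFm : ∀ y ∈ X, μ * ‖y - xs‖ ^ 2 ≤ inner ℝ (gF y) (y - xs)) (hE : 0 ≤ 2 * Hb + 10 * α₂ * H)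
    {t : ℕ} (hmt : m ≤ t) (htK : t ≤ K) :
    ‖x (t + 1) - xs‖ ^ 2 ≤ ‖x t - xs‖ ^ 2 - 2 * γ * (μ / L) * ‖x t - xs‖ +
      2 * γ * (1 + μ / L) *
        (√d * (2 * Hb + 10 * α₂ * H + 18 * (L * (γ * (m - 1)))) / μ) + γ ^ 2 +
      2 * γ * (1 + μ / L) * (‖x t - xs‖ *
        (if WindowFails α₁ α₂ (fun τ : Fin m => W (t - m + 1 + τ)) then 1 else 0)) := by
  have hmem := fun s hs1 hst => h.mem hx₁ (t := s) hs1 hst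
  have hdist := fun s hs n hK => h.norm_sub_le hx₁ hX hγ (s := s) hs n hK
  obtain ⟨-, g, gh, gg, hrun⟩ := h
  obtain ⟨-, -, hgh, hgg, hproj⟩ := hrun t (by omega) htK
  have hstep := norm_sub_sq_step_le hX hγ hxs hproj
  have hL : 0 < L := hμ.trans_le hμL
  have hxt := hmem t (by omega) (by omega)
  have hr0 : 0 < μ / L := by positivity
  set v := ‖x t - xs‖ with hv
  have hv0 : 0 ≤ v := norm_nonneg _
  set E := √d * (2 * Hb + 10 * α₂ * H + 18 * (L * (γ * ((m : ℝ) - 1)))) with hEdef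
  have hm1 : (1 : ℝ) ≤ m := by exact_mod_cast hm
  have hE0 : 0 ≤ E := by
    have : 0 ≤ L * (γ * ((m : ℝ) - 1)) := mul_nonneg hL.le (mul_nonneg hγ (by linarith))
    positivity
  have hEμ : 0 ≤ E / μ := by positivity
  split_ifs with hW
  -- On failure the direction may point straight away from `xs`. Compared with the progress `(μ / L)
  -- v`, the loss is `(1 + μ / L) v`, the indicator term.
  · have h1 := (abs_le.1 (abs_real_inner_le_norm (‖gg t‖⁻¹ • gg t) (x t - xs))).1
    have h2 : -v ≤ inner ℝ (‖gg t‖⁻¹ • gg t) (x t - xs) := by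
      have := mul_le_mul_of_nonneg_right (norm_normalize_le (gg t)) hv0
      linarith
    have h3 := mul_le_mul_of_nonneg_left h2 (show 0 ≤ 2 * γ by positivity)
    have h4 : 0 ≤ 2 * γ * (1 + μ / L) * (E / μ) := by positivity
    rw [mul_one]
    linarith
  · have h1 := norm_aggregate_sub_le (gF := gF) hN hm hmt hγ hL.le hα₁ hα₂ hα₂0
      (fun s h1 h2 => hmem s h1 (by omega))
      (fun s n h1 h2 => by have := hdist s h1 n (by omega); rwa [h2] at this)
      (fun s h1 h2 => (hrun s h1 (by omega)).1) (hgh hmt) hgg hlip hH hHb hW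
    have h2 := le_inner_normalize hμ hμL h1 (hF _ hxt) (hFm _ hxt)
    have h3 := mul_le_mul_of_nonneg_left h2 (show 0 ≤ 2 * γ by positivity)
    rw [mul_zero, mul_zero, add_zero]
    linarith

end Run

/-! ### The recursion in expectation -/

theorem le_geometric_of_step {a : ℕ → ℝ} {q β : ℝ} (hq : 0 < q) (hq1 : q ≤ 1) {T : ℕ}
    (h : ∀ k < T, a (k + 1) ≤ (1 - q) * a k + β) : a T ≤ a 0 * (1 - q) ^ T + β / q * (1 - (1 - q) ^ T) := by
  induction T with
  | zero => simp
  | succ n ih =>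
    have h1 := ih fun k hk => h k (by omega)
    have h2 := mul_le_mul_of_nonneg_left h1 (sub_nonneg.2 hq1)
    refine (h n (by omega)).trans ((add_le_add_left h2 β).trans (le_of_eq ?_))
    rw [pow_succ]
    field_simp
    ring

-- The pathwise inequality is integrated with `s` as conditioning time: the failure window occupies
-- the last `m` of the `m₀ + m` iterations from `s` to `t`.
open Classical in
theorem integral_norm_sub_sq_le {d N : ℕ} {X : Set (Vec d)} {Ω : Type*} {mΩ : MeasurableSpace Ω}
    {P : Measure Ω} [IsProbabilityMeasure P] {ℱ : Filtration ℕ mΩ} {pb pt : ℝ}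
    {W : ℕ → Ω → Config N} (hW : IsAgentChain P ℱ pb pt W)
    {localGrad : Ω → Fin N → Vec d → Vec d} {m m₀ K : ℕ} {α₁ α₂ γ : ℝ} {x₁ : Vec d}
    {x : ℕ → Ω → Vec d} (hx : Adapted ℱ x)
    (h : ∀ ω, IsRangeRun X (localGrad ω) m α₁ α₂ γ K (fun t => W t ω) x₁ (fun t => x t ω))
    (hx₁ : x₁ ∈ X) (hX : Convex ℝ X) (hγ : 0 ≤ γ) {gF : Vec d → Vec d} {L μ R pZ : ℝ} {xs : Vec d}
    (hxs : xs ∈ X) (hXR : ∀ y ∈ X, ‖y - xs‖ ≤ R)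
    (hN : 1 ≤ N) (hm : 1 ≤ m) (hμ : 0 < μ) (hμL : μ ≤ L) (hα₁ : α₁ < 1 / 2) (hα₂ : α₂ < 1 / 2)
    (hα₂0 : 0 ≤ α₂) (hpZ : failureProb m₀ m N α₁ α₂ pb pt ≤ pZ) (hpZ0 : 0 ≤ pZ) {H Hb : Ω → ℝ}
    (hHi : Integrable H P) (hHbi : Integrable Hb P)
    (hlip : ∀ ω i, ∀ y ∈ X, ∀ z ∈ X, ‖localGrad ω i y - localGrad ω i z‖ ≤ L * ‖y - z‖)
    (hH : ∀ ω i, ∀ y ∈ X, ∀ j, |localGrad ω i y j - gF y j| ≤ H ω)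
    (hHb : ∀ ω, ∀ y ∈ X, ∀ j, |1 / (N : ℝ) * ∑ i, (localGrad ω i y j - gF y j)| ≤ Hb ω)
    (hF : ∀ y ∈ X, ‖gF y‖ ≤ L * ‖y - xs‖)
    (hFm : ∀ y ∈ X, μ * ‖y - xs‖ ^ 2 ≤ inner ℝ (gF y) (y - xs))
    (hE : ∀ ω, 0 ≤ 2 * Hb ω + 10 * α₂ * H ω) {s t : ℕ} (hs : 1 ≤ s) (hst : t + 1 = s + (m₀ + m))
    (htK : t ≤ K) :
    ∫ ω, ‖x (t + 1) ω - xs‖ ^ 2 ∂P ≤ ∫ ω, ‖x t ω - xs‖ ^ 2 ∂P -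
      2 * γ * (μ / L - pZ * (1 + μ / L)) * ∫ ω, ‖x t ω - xs‖ ∂P +
      γ ^ 2 * (1 + 4 * pZ * (1 + μ / L) * ((m : ℝ) - 1 + m₀)) +
      2 * γ * (1 + μ / L) * (√d * (2 * ∫ ω, Hb ω ∂P + 10 * α₂ * ∫ ω, H ω ∂P +
        18 * (L * (γ * (m - 1)))) / μ) := by
  have hxm : ∀ r, Measurable fun ω => ‖x r ω - xs‖ := fun r =>
    (((hx r).mono (ℱ.le r) le_rfl).sub_const xs).norm
  have hmem : ∀ r, 1 ≤ r → r ≤ K + 1 → ∀ ω, ‖x r ω - xs‖ ≤ R := fun r h1 h2 ω =>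
    hXR _ ((h ω).mem hx₁ h1 h2)
  have hint : ∀ r, 1 ≤ r → r ≤ K + 1 → Integrable (fun ω => ‖x r ω - xs‖) P := fun r h1 h2 =>
    (integrable_const R).mono' (hxm r).aestronglyMeasurable
      (Filter.Eventually.of_forall fun ω => by simpa using hmem r h1 h2 ω)
  have hint2 : ∀ r, 1 ≤ r → r ≤ K + 1 → Integrable (fun ω => ‖x r ω - xs‖ ^ 2) P := fun r h1 h2 =>
    (integrable_const (R ^ 2)).mono' ((hxm r).pow_const 2).aestronglyMeasurable
      (Filter.Eventually.of_forall fun ω => by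
        rw [Real.norm_eq_abs, abs_of_nonneg (by positivity)]
        exact pow_le_pow_left₀ (norm_nonneg _) (hmem r h1 h2 ω) 2)
  have ht1 : 1 ≤ t := by omega
  have hL : 0 < L := hμ.trans_le hμL
  have hr0 : 0 < μ / L := by positivity
  set I : Ω → ℝ := fun ω =>
    if WindowFails α₁ α₂ (fun τ : Fin m => W (t - m + 1 + τ) ω) then 1 else 0 with hI
  have hIm : Measurable I := by
    have hw : Measurable fun ω => fun τ : Fin m => W (t - m + 1 + τ) ω :=
      measurable_pi_lambda _ fun τ => (hW.1 _).mono (ℱ.le _) le_rfl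
    exact (measurable_of_countable fun v : Fin m → Config N =>
      if WindowFails α₁ α₂ v then (1 : ℝ) else 0).comp hw
  have hI01 : ∀ ω, 0 ≤ I ω ∧ I ω ≤ 1 := by
    intro ω
    simp only [hI]
    split_ifs <;> norm_num
  have hdI : ∀ f : Ω → ℝ, Integrable f P → Integrable (fun ω => f ω * I ω) P := fun f hf =>
    hf.mul_bdd (c := 1) hIm.aestronglyMeasurable (Filter.Eventually.of_forall fun ω => by
      rw [Real.norm_eq_abs, abs_of_nonneg (hI01 ω).1]; exact (hI01 ω).2)
  -- the failure event and the past
  set n : ℝ := (m : ℝ) - 1 + m₀ with hn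
  have hm1 : (1 : ℝ) ≤ m := by exact_mod_cast hm
  have hn0 : 0 ≤ n := by rw [hn]; have : (0 : ℝ) ≤ m₀ := Nat.cast_nonneg _; linarith
  have hclose : ∀ ω, |‖x t ω - xs‖ - ‖x s ω - xs‖| ≤ γ * n := by
    intro ω
    have h1 := (h ω).norm_sub_le hx₁ hX hγ hs (m₀ + m - 1) (by omega)
    rw [show s + (m₀ + m - 1) = t by omega] at h1
    have h2 : ((m₀ + m - 1 : ℕ) : ℝ) = n := by
      rw [hn, Nat.cast_sub (by omega)]; push_cast; ring
    rw [h2] at h1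
    refine (abs_norm_sub_norm_le _ _).trans ?_
    rwa [sub_sub_sub_cancel_right]
  have hfail : ∫ ω, ‖x t ω - xs‖ * I ω ∂P ≤ pZ * (∫ ω, ‖x t ω - xs‖ ∂P + 2 * (γ * n)) := by
    -- A majorant of `‖x t ω - xs‖` that is known at time `s`. Returning from it to `x t` after the
    -- Markov bound costs a second `γ * n`, whence the factor `4 * pZ` in the conclusion.
    set φ : Ω → ℝ := fun ω => ‖x s ω - xs‖ + γ * n with hφ
    have hφ0 : ∀ ω, 0 ≤ φ ω := fun ω => by positivity
    have hφi : Integrable φ P := (hint s hs (by omega)).add (integrable_const _)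
    have hgm : Measurable fun y : Vec d => ‖y - xs‖ + γ * n := by fun_prop
    have h1 := hW.integral_windowFails_le hs (φ := φ) (c := R + γ * n)
      (hgm.comp (hx s))
      (fun ω => by
        rw [abs_of_nonneg (hφ0 ω)]
        exact add_le_add_left (hmem s hs (by omega) ω) _)
      hφ0 (m₀ := m₀) hm α₁ α₂
    have h2 : ∀ ω, (if WindowFails α₁ α₂ (fun τ : Fin m => W (s + (m₀ + τ)) ω) then (1 : ℝ)
        else 0) = I ω := by
      intro ω
      have : ∀ τ : Fin m, s + (m₀ + τ) = t - m + 1 + τ := fun τ => by omega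
      simp only [hI, this]
    simp only [h2] at h1
    have h3 : ∫ ω, ‖x t ω - xs‖ * I ω ∂P ≤ ∫ ω, φ ω * I ω ∂P :=
      integral_mono (hdI _ (hint t ht1 (by omega))) (hdI _ hφi) fun ω =>
        mul_le_mul_of_nonneg_right (by have := (abs_le.1 (hclose ω)).2; simp only [hφ]; linarith)
          (hI01 ω).1
    have h4 : ∫ ω, φ ω ∂P ≤ ∫ ω, ‖x t ω - xs‖ ∂P + 2 * (γ * n) := by
      have h5 : ∫ ω, (‖x t ω - xs‖ + 2 * (γ * n)) ∂P = ∫ ω, ‖x t ω - xs‖ ∂P + 2 * (γ * n) := by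
        rw [integral_add (hint t ht1 (by omega)) (integrable_const _)]
        simp
      rw [← h5]
      refine integral_mono hφi ((hint t ht1 (by omega)).add (integrable_const _)) fun ω => ?_
      have := (abs_le.1 (hclose ω)).1
      show ‖x s ω - xs‖ + γ * n ≤ ‖x t ω - xs‖ + 2 * (γ * n)
      linarith
    calc _ ≤ failureProb m₀ m N α₁ α₂ pb pt * ∫ ω, φ ω ∂P := h3.trans h1
      _ ≤ pZ * ∫ ω, φ ω ∂P := mul_le_mul_of_nonneg_right hpZ (integral_nonneg hφ0)
      _ ≤ _ := mul_le_mul_of_nonneg_left h4 hpZ0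
  -- integrate the pathwise bound
  set A := 2 * γ * (μ / L) with hA
  set B := 2 * γ * (1 + μ / L) with hB
  have hB0 : 0 ≤ B := by positivity
  set c := γ ^ 2 + B * (√d / μ * (18 * (L * (γ * ((m : ℝ) - 1))))) with hc
  have hpath : ∀ ω, ‖x (t + 1) ω - xs‖ ^ 2 ≤ ‖x t ω - xs‖ ^ 2 - A * ‖x t ω - xs‖ +
      (B * (√d / μ * 2)) * Hb ω + (B * (√d / μ * (10 * α₂))) * H ω +
      B * (‖x t ω - xs‖ * I ω) + c := by
    intro ω
    have := (h ω).norm_sub_sq_le hx₁ hX hγ hxs hN hm hμ hμL hα₁ hα₂ hα₂0 (hlip ω) (hH ω) (hHb ω) hF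
      hFm (hE ω) (t := t) (by omega) htK
    refine this.trans (le_of_eq ?_)
    simp only [hI, hc]
    ring
  have i1 := hint2 t ht1 (by omega)
  have i2 := (hint t ht1 (by omega)).const_mul A
  have i3 := hHbi.const_mul (B * (√d / μ * 2))
  have i4 := hHi.const_mul (B * (√d / μ * (10 * α₂)))
  have i5 := (hdI _ (hint t ht1 (by omega))).const_mul B
  have j2 := i1.sub i2
  have j3 := j2.add i3
  have j4 := j3.add i4
  have j5 := j4.add i5
  have j6 := j5.add (integrable_const c)
  simp only [Pi.sub_def, Pi.add_def] at j2 j3 j4 j5 j6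
  have hmono := integral_mono (hint2 (t + 1) (by omega) (by omega))
    j6 hpath
  rw [integral_add j5 (integrable_const c), integral_add j4 i5, integral_add j3 i4,
    integral_add j2 i3, integral_sub i1 i2] at hmono
  simp only [integral_const_mul, integral_const, probReal_univ, smul_eq_mul, one_mul] at hmono
  have h6 := mul_le_mul_of_nonneg_left hfail hB0
  refine hmono.trans (le_trans (add_le_add_left (add_le_add_right h6 _) _) (le_of_eq ?_))
  simp only [hc, hA, hB]
  ring

/-! ### The empirical gradients -/

theorem gradient_empiricalRisk_apply_sub {d b : ℕ} {Z : Type*} {f : Vec d → Z → ℝ}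
    {X : Set (Vec d)} {L : ℝ} (hf : ∀ z, IsSmoothOn L X (fun x => f x z)) (hb : 1 ≤ b)
    (zs : Fin b → Z) {x : Vec d} (hx : x ∈ X) (k : Fin d) (c : ℝ) :
    gradient (empiricalRisk f zs) x k - c =
      1 / (b : ℝ) * ∑ j, (gradient (fun u => f u (zs j)) x k - c) := by
  have hb0 : (b : ℝ) ≠ 0 := by positivity
  rw [gradient_empiricalRisk hf zs hx, Finset.sum_sub_distrib]
  simp only [PiLp.smul_apply, WithLp.ofLp_sum, Finset.sum_apply, smul_eq_mul, Finset.sum_const,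
    Finset.card_univ, Fintype.card_fin, nsmul_eq_mul]
  field_simp

theorem norm_gradient_empiricalRisk_sub_le {d b : ℕ} {Z : Type*} {f : Vec d → Z → ℝ}
    {X : Set (Vec d)} {L : ℝ} (hf : ∀ z, IsSmoothOn L X (fun x => f x z)) (hb : 1 ≤ b)
    (zs : Fin b → Z) {x y : Vec d} (hx : x ∈ X) (hy : y ∈ X) :
    ‖gradient (empiricalRisk f zs) x - gradient (empiricalRisk f zs) y‖ ≤ L * ‖x - y‖ := by
  have hb0 : (0 : ℝ) < b := by exact_mod_cast hb
  rw [gradient_empiricalRisk hf zs hx, gradient_empiricalRisk hf zs hy, ← smul_sub,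
    ← Finset.sum_sub_distrib, norm_smul, Real.norm_eq_abs, abs_of_pos (by positivity),
    one_div_mul_eq_div, div_le_iff₀ hb0]
  calc _ ≤ ∑ _j : Fin b, L * ‖x - y‖ := norm_sum_le_of_le _ fun j _ => (hf (zs j)).2 x hx y hy
    _ = _ := by simp; ring

/-! ### Constants -/

/-- Allows the trimming errors, obtained as multiples of `α`, to be charged to `C_α`. -/
theorem two_mul_le_robustConst {d : ℕ} (hd : 1 ≤ d) {α : ℝ} (h0 : 0 ≤ α) (h1 : α < 1 / 2) :
    2 * α ≤ robustConst d α := by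
  have hsd : 1 ≤ √(d : ℝ) := Real.one_le_sqrt.2 (by exact_mod_cast hd)
  unfold robustConst
  have e1 : 2 * α ≤ 2 * α / (1 - α) := by
    rw [le_div_iff₀ (by linarith)]; nlinarith
  have e2 : (1 : ℝ) ≤ 1 + √((1 - α) ^ 2 / (1 - 2 * α)) := by
    linarith [Real.sqrt_nonneg ((1 - α) ^ 2 / (1 - 2 * α))]
  have e3 : 0 ≤ 2 * α / (1 - α) := div_nonneg (by linarith) (by linarith)
  nlinarith [mul_nonneg e3 (sub_nonneg.2 e2),
    mul_nonneg (mul_nonneg e3 (zero_le_one.trans e2)) (sub_nonneg.2 hsd)]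

theorem nonneg_of_mul_eq_natCast {α : ℝ} {N : ℕ} (hN : 1 ≤ N) (hα : ∃ k : ℕ, α * N = k) :
    0 ≤ α := by
  obtain ⟨k, hk⟩ := hα
  have hN1 : (0 : ℝ) < N := by exact_mod_cast hN
  by_contra! h
  have := mul_neg_of_neg_of_pos h hN1
  rw [hk] at this
  exact absurd this (not_lt.2 (Nat.cast_nonneg k))

/-- The logarithmic factor for all agents, when at least one agent may be trimmed. -/
theorem mul_deviation_le {d N b : ℕ} (hd : 1 ≤ d) (hN : 1 ≤ N) {α : ℝ}
    (h1 : α < 1 / 2) (hα : ∃ k : ℕ, α * N = k) :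
    2 * α * (√(Real.log (2 * d * N)) / √b + Real.log (2 * d * N) / b) ≤
      2 * robustConst d α * (√(Real.log (2 * (1 - α) * N * d)) / √b +
        Real.log (2 * (1 - α) * N * d) / b) := by
  have h0 := nonneg_of_mul_eq_natCast hN hα
  obtain ⟨k, hk⟩ := hα
  have hd1 : (1 : ℝ) ≤ d := by exact_mod_cast hd
  have hN1 : (1 : ℝ) ≤ N := by exact_mod_cast hN
  rcases Nat.eq_zero_or_pos k with rfl | hk0
  · have : α = 0 := by
      rw [Nat.cast_zero] at hk
      rcases mul_eq_zero.1 hk with h | h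
      · exact h
      · linarith
    subst this
    simp [robustConst]
  have hk1 : (1 : ℝ) ≤ k := by exact_mod_cast hk0
  -- Trimming at least one agent with `α < 1/2` forces `N > 2`. Then `N d ≥ 2`, and the factor `2`
  -- inside the logarithm costs at most a factor `2` outside.
  have hN2 : (2 : ℝ) < N := by nlinarith
  have hNd : (2 : ℝ) ≤ N * d := by nlinarith
  have hle : Real.log (N * d) ≤ Real.log (2 * (1 - α) * N * d) := by
    refine Real.log_le_log (by linarith) ?_
    nlinarith
  have hlog : Real.log (2 * d * N) ≤ 2 * Real.log (2 * (1 - α) * N * d) := by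
    rw [show 2 * (d : ℝ) * N = 2 * (N * d) by ring, Real.log_mul (by norm_num) (by linarith)]
    have := Real.log_le_log (by norm_num) hNd
    linarith
  set Λ := Real.log (2 * (1 - α) * N * d) with hΛ
  have hΛ0 : 0 ≤ Λ := (Real.log_nonneg (by linarith)).trans hle
  have hsq : √(Real.log (2 * d * N)) ≤ 2 * √Λ := by
    refine (Real.sqrt_le_sqrt hlog).trans ?_
    rw [Real.sqrt_le_iff]
    refine ⟨by positivity, ?_⟩
    rw [mul_pow, Real.sq_sqrt hΛ0]
    linarith
  have hb : √(Real.log (2 * d * N)) / √b + Real.log (2 * d * N) / b ≤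
      2 * (√Λ / √b + Λ / b) := by
    have e1 : √(Real.log (2 * d * N)) / √b ≤ 2 * √Λ / √b := by gcongr
    have e2 : Real.log (2 * d * N) / b ≤ 2 * Λ / b := by gcongr
    rw [mul_div_assoc] at e1 e2
    linarith
  have hp : 0 ≤ √Λ / √b + Λ / b := by positivity
  calc _ ≤ 2 * α * (2 * (√Λ / √b + Λ / b)) := by gcongr
    _ = 2 * (2 * α) * (√Λ / √b + Λ / b) := by ring
    _ ≤ _ := by
      have := two_mul_le_robustConst hd h0 h1
      gcongr

theorem robustConst_nonneg (d : ℕ) {α : ℝ} (h0 : 0 ≤ α) (h1 : α < 1 / 2) :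
    0 ≤ robustConst d α := by
  unfold robustConst
  have : 0 ≤ 2 * α / (1 - α) := div_nonneg (by linarith) (by linarith)
  positivity

/-- The delay and step size terms are of the order of the statistical error. -/
theorem step_terms_le {d m m₀ N b : ℕ} (hm : 1 ≤ m) (hN : 1 ≤ N) (hb : 1 ≤ b)
    {α₁ α₂ κ μ σ γ pZ : ℝ} (hκ : 0 < κ) (hμ : 0 < μ) (hσ : 0 < σ) (hpZ : 0 ≤ pZ) (hγ : 0 ≤ γ)
    (h1 : 0 ≤ α₁) (h1' : α₁ < 1 / 2) (h2 : 0 ≤ α₂) (h2' : α₂ < 1 / 2)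
    (hstep : γ ≤ 4 * σ / (stepConst d m m₀ α₁ α₂ κ pZ * μ * √((1 - α₂) * N * b))) :
    γ * (1 + 4 * pZ * (1 + 1 / κ) * ((m : ℝ) - 1 + m₀) + 4 * κ * ((m : ℝ) - 1)) ≤
      8 * σ / μ * (1 / √(N * b)) := by
  have hm1 : (0 : ℝ) ≤ m - 1 := by
    have : (1 : ℝ) ≤ m := by exact_mod_cast hm
    linarith
  have hN0 : (0 : ℝ) < N := by exact_mod_cast hN
  have hb0 : (0 : ℝ) < b := by exact_mod_cast hb
  have hm0 : (0 : ℝ) ≤ m₀ := Nat.cast_nonneg _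
  have c1 := robustConst_nonneg d h1 h1'
  have c2 := robustConst_nonneg d h2 h2'
  have hA : 1 + 4 * pZ * (1 + 1 / κ) * ((m : ℝ) - 1 + m₀) + 4 * κ * ((m : ℝ) - 1) ≤
      stepConst d m m₀ α₁ α₂ κ pZ := by
    unfold stepConst
    have : 0 ≤ 4 * κ * ((m : ℝ) - 1) *
        (robustConst d α₁ + 2 * robustConst d α₂ * (robustConst d α₁ + 1)) := by positivity
    linarith
  have hA1 : 1 ≤ 1 + 4 * pZ * (1 + 1 / κ) * ((m : ℝ) - 1 + m₀) + 4 * κ * ((m : ℝ) - 1) := by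
    have e1 : 0 ≤ 4 * pZ * (1 + 1 / κ) * ((m : ℝ) - 1 + m₀) := by positivity
    have e2 : 0 ≤ 4 * κ * ((m : ℝ) - 1) := by positivity
    linarith
  set S := stepConst d m m₀ α₁ α₂ κ pZ with hS
  have hS0 : 0 < S := by linarith
  -- Only `1 - α₂ ≥ 1/4` is needed; this turns `4 σ` into `8 σ`.
  have hsq : √(N * b : ℝ) / 2 ≤ √((1 - α₂) * N * b) := by
    refine Real.le_sqrt_of_sq_le ?_
    rw [div_pow, Real.sq_sqrt (by positivity), mul_assoc]
    have : (0 : ℝ) < N * b := by positivity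
    nlinarith
  have hq : 0 < √(N * b : ℝ) := Real.sqrt_pos.2 (by positivity)
  calc _ ≤ γ * S := by gcongr
    _ ≤ 4 * σ / (S * μ * √((1 - α₂) * N * b)) * S := by gcongr
    _ ≤ 4 * σ / (S * μ * (√(N * b : ℝ) / 2)) * S := by gcongr
    _ = _ := by field_simp; norm_num

theorem log_trimmed_nonneg {d N : ℕ} (hd : 1 ≤ d) (hN : 1 ≤ N) {α : ℝ} (h1 : α < 1 / 2) :
    0 ≤ Real.log (2 * (1 - α) * N * d) := by
  have hNd : (1 : ℝ) ≤ N * d := by exact_mod_cast Nat.mul_pos hN hd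
  refine Real.log_nonneg ?_
  nlinarith

/-- The terms of the recursion that do not contract are of the order of the statistical error. -/
theorem error_terms_le {s κ L μ σ γ pZ k n S Q E C : ℝ} (hs : 1 ≤ s) (hκ : κ = L / μ) (hμ : 0 < μ)
    (hL : 0 < L) (hσ : 0 < σ) (hγ : 0 ≤ γ) (hpZ : 0 ≤ pZ) (hκ1 : 1 / κ ≤ 1) (hk : 0 ≤ k)
    (hn : 0 ≤ n) (hQ : 0 ≤ Q)
    (hstep : γ * (1 + 4 * pZ * (1 + 1 / κ) * n + 4 * κ * k) ≤ 8 * σ / μ * S)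
    (hE0 : 0 ≤ E) (hE : E ≤ C * (S + Q)) :
    γ * (1 + 4 * pZ * (1 + 1 / κ) * n) +
      2 * (1 + 1 / κ) * (s * (E + 18 * (L * (γ * k))) / μ) ≤
        (144 * s * σ / μ + 4 * s / μ * C) * (S + Q) := by
  have hκ0 : 0 < κ := by rw [hκ]; positivity
  have e1 : 2 * (1 + 1 / κ) * (s * (E + 18 * (L * (γ * k))) / μ) ≤
      4 * (s * (E + 18 * (L * (γ * k))) / μ) := by
    refine mul_le_mul_of_nonneg_right (by linarith) (by positivity)
  have e2 : 4 * (s * (E + 18 * (L * (γ * k))) / μ) =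
      4 * s / μ * E + 18 * s * (γ * (4 * κ * k)) := by
    rw [hκ]; field_simp
  have e3 : 4 * s / μ * E ≤ 4 * s / μ * (C * (S + Q)) := by gcongr
  have e4 := mul_le_mul_of_nonneg_left hstep (show 0 ≤ 18 * s by positivity)
  have e5 : γ * (1 + 4 * pZ * (1 + 1 / κ) * n) ≤
      18 * s * (γ * (1 + 4 * pZ * (1 + 1 / κ) * n)) :=
    le_mul_of_one_le_left (by positivity) (by linarith)
  have e6 : 18 * s * (8 * σ / μ * S) ≤ 144 * s * σ / μ * (S + Q) := by
    have : 0 ≤ 144 * s * σ / μ * Q := by positivity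
    have e : 18 * s * (8 * σ / μ * S) = 144 * s * σ / μ * S := by ring
    rw [e, mul_add]
    linarith
  linarith

/-- The modulus of strong monotonicity is at most the Lipschitz constant of the gradient. -/
theorem IsStronglyConvexOn.le_of_lipschitz {d : ℕ} {μ L : ℝ} {X : Set (Vec d)} {h : Vec d → ℝ}
    (hsc : IsStronglyConvexOn μ X h) (hX : X.Nontrivial)
    (hlip : ∀ x ∈ X, ∀ y ∈ X, ‖gradient h x - gradient h y‖ ≤ L * ‖x - y‖) : μ ≤ L := by
  obtain ⟨y, hy, w, hw, hyw⟩ := hX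
  have h1 := hsc.2 y hy w hw
  have h2 := (real_inner_le_norm _ _).trans
    (mul_le_mul_of_nonneg_right (hlip y hy w hw) (norm_nonneg (y - w)))
  have h3 : 0 < ‖y - w‖ ^ 2 := by
    have := norm_pos_iff.2 (sub_ne_zero.2 hyw)
    positivity
  refine le_of_mul_le_mul_right ?_ h3
  linarith

/-- The deviations of the overall average and of the individual empirical gradients. -/
theorem exists_empirical_deviations {d : ℕ} {Z : Type*} [MeasurableSpace Z] {D : Measure Z}
    [IsProbabilityMeasure D] {f : Vec d → Z → ℝ} {X : Set (Vec d)} {σ a L : ℝ} (hd : 1 ≤ d)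
    (h : HasSubGammaNoise D f X σ a) (hσ : 0 < σ) (ha : 0 ≤ a) (hL : 0 < L)
    (hf : ∀ z, IsSmoothOn L X (fun x => f x z)) {xs : Vec d} (hxs : xs ∈ X) {R : ℝ} (hR : 0 < R)
    (hX : ∀ x ∈ X, ‖x - xs‖ ≤ R) {Ω : Type*} [MeasurableSpace Ω] {P : Measure Ω}
    [IsProbabilityMeasure P] {N b : ℕ} (hN : 1 ≤ N) (hb : 1 ≤ b) {z : Fin N → Fin b → Ω → Z}
    (hz : ∀ i j, Measurable (z i j)) (hD : ∀ i j, P.map (z i j) = D)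
    (hind : iIndepFun (fun q : Fin N × Fin b => z q.1 q.2) P) :
    ∃ H Hb : Ω → ℝ, Integrable H P ∧ Integrable Hb P ∧
      (∀ ω i, ∀ x ∈ X, ∀ k, |gradient (empiricalRisk f fun j => z i j ω) x k -
        gradient (expectedCost D f) x k| ≤ H ω) ∧
      (∀ ω, ∀ x ∈ X, ∀ k, |1 / (N : ℝ) * ∑ i, (gradient (empiricalRisk f fun j => z i j ω) x k -
        gradient (expectedCost D f) x k)| ≤ Hb ω) ∧
      ∫ ω, H ω ∂P ≤ (2 * σ + 64 * L * √d * R * d + 2 * a + 1) *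
        (√(Real.log (2 * d * N)) / √b + Real.log (2 * d * N) / b) ∧
      ∫ ω, Hb ω ∂P ≤ (2 * σ + 64 * L * √d * R * d + 2 * a + 1) *
        ((√(Real.log (2 * d)) + Real.log (2 * d)) * (1 / √(N * b))) := by
  have : Nonempty (Fin N) := ⟨⟨0, hN⟩⟩
  have : Nonempty (Fin b) := ⟨⟨0, hb⟩⟩
  obtain ⟨H, hHi, hH, hHe⟩ := exists_gradient_deviation hd h hσ ha hL hf hxs hR hX hz hD
    fun i => hind.precomp (g := fun j : Fin b => (i, j)) fun j j' hj => by simpa using hj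
  -- The pooled sample is treated as one batch of size `N b`, so its logarithm does not involve `N`.
  obtain ⟨Hb, hHbi, hHb, hHbe⟩ := exists_gradient_deviation (ι := Unit) (n := Fin N × Fin b)
    hd h hσ ha hL hf hxs hR hX (z := fun _ q => z q.1 q.2) (fun _ q => hz q.1 q.2)
    (fun _ q => hD q.1 q.2) fun _ => hind
  refine ⟨H, Hb, hHi, hHbi, fun ω i x hx k => ?_, fun ω x hx k => ?_, ?_, ?_⟩
  · rw [gradient_empiricalRisk_apply_sub hf hb _ hx]
    simpa using hH ω i x hx k
  · have e : 1 / (N : ℝ) * ∑ i, (gradient (empiricalRisk f fun j => z i j ω) x k -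
        gradient (expectedCost D f) x k) = 1 / (Fintype.card (Fin N × Fin b) : ℝ) *
          ∑ q : Fin N × Fin b, (gradient (fun u => f u (z q.1 q.2 ω)) x k -
            gradient (expectedCost D f) x k) := by
      simp_rw [gradient_empiricalRisk_apply_sub hf hb _ hx]
      rw [← Finset.mul_sum, Fintype.sum_prod_type, ← mul_assoc]
      congr 1
      rw [Fintype.card_prod, Fintype.card_fin, Fintype.card_fin]
      push_cast
      rw [one_div_mul_one_div]
    rw [e]
    exact hHb ω () x hx k
  · simpa using hHe
  · refine hHbe.trans (mul_le_mul_of_nonneg_left ?_ (by positivity))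
    simp only [Fintype.card_unit, Fintype.card_prod, Fintype.card_fin, Nat.cast_mul, Nat.cast_one,
      mul_one]
    have hNb : (1 : ℝ) ≤ N * b := by exact_mod_cast Nat.mul_pos hN hb
    have hd1 : (1 : ℝ) ≤ d := by exact_mod_cast hd
    have hl : 0 ≤ Real.log (2 * d) := Real.log_nonneg (by linarith)
    have hs1 : 1 ≤ √(N * b : ℝ) := Real.one_le_sqrt.2 hNb
    have : Real.log (2 * d) / (N * b) ≤ Real.log (2 * d) / √(N * b) := by
      refine div_le_div_of_nonneg_left hl (by linarith) ?_
      nth_rewrite 2 [← Real.mul_self_sqrt (by linarith : (0 : ℝ) ≤ N * b)]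
      nlinarith
    calc _ ≤ √(Real.log (2 * d)) / √(N * b) + Real.log (2 * d) / √(N * b) := by linarith
      _ = _ := by ring

end RangeSAA

/-! ### Assembly of the convergence bound -/

theorem theorem1 (d : ℕ) (μ L R σ a : ℝ) (hμ : 0 < μ) (hL : 0 < L) (hR : 0 < R)
    (hσ : 0 < σ) (ha : 0 ≤ a) :
    -- the constant of the error term depends only on `d, μ, L, R, σ, a`
    ∃ C : ℝ, 0 < C ∧
      ∀ {Z : Type*} [MeasurableSpace Z] (D : Measure Z) [IsProbabilityMeasure D]
        (f : RangeSAA.Vec d → Z → ℝ) (X : Set (RangeSAA.Vec d)) (xs : RangeSAA.Vec d)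
        -- the expected cost is well defined
        (_ : ∀ x, Integrable (f x) D)
        -- the assumptions on the cost, the noise, the feasible set and the minimizer
        (_ : RangeSAA.IsStronglyConvexOn μ X (RangeSAA.expectedCost D f))
        (_ : RangeSAA.HasSubGammaNoise D f X σ a)
        (_ : ∀ z, RangeSAA.IsSmoothOn L X (fun x => f x z))
        (_ : Convex ℝ X) (_ : IsCompact X) (_ : Metric.diam X = R)
        (_ : xs ∈ X) (_ : ∀ y ∈ X, y ≠ xs → RangeSAA.expectedCost D f xs <
          RangeSAA.expectedCost D f y)
        (_ : gradient (RangeSAA.expectedCost D f) xs = 0)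
        -- the parameters of the network and of the algorithm
        (N b m m₀ T : ℕ) (_ : 1 ≤ N) (_ : 1 ≤ b) (_ : 1 ≤ m) (_ : 1 ≤ T)
        (α₁ α₂ pb pt γ : ℝ) (_ : 0 < pb) (_ : pb < pt) (_ : pt < 1)
        (_ : α₁ < 1 / 2) (_ : ∃ k : ℕ, α₁ * m = k)
        (_ : α₂ < 1 / 2) (_ : ∃ k : ℕ, α₂ * N = k)
        -- `pZ` is a uniform bound on the conditional probability of `Z_t = 1`
        (pZ : ℝ) (_ : RangeSAA.failureProb m₀ m N α₁ α₂ pb pt ≤ pZ)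
        (_ : pZ < 1 / (1 + L / μ))
        -- the step size
        (_ : 0 < γ)
        (_ : γ ≤ 4 * σ /
          (RangeSAA.stepConst d m m₀ α₁ α₂ (L / μ) pZ * μ * √((1 - α₂) * N * b)))
        (_ : RangeSAA.contractionConst (L / μ) R pZ * γ ≤ 1)
        -- the probability space, the data (drawn once), the agents' states, the iterates
        {Ω : Type*} {mΩ : MeasurableSpace Ω} (Pr : Measure Ω) [IsProbabilityMeasure Pr]
        (ℱ : Filtration ℕ mΩ)
        (z : Fin N → Fin b → Ω → Z) (_ : ∀ i j, Measurable (z i j))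
        (_ : ∀ i j, Pr.map (z i j) = D)
        (_ : iIndepFun (fun q : Fin N × Fin b => z q.1 q.2) Pr)
        (W : ℕ → Ω → RangeSAA.Config N) (_ : RangeSAA.IsAgentChain Pr ℱ pb pt W)
        (x₁ : RangeSAA.Vec d) (_ : x₁ ∈ X)
        (x : ℕ → Ω → RangeSAA.Vec d) (_ : Adapted ℱ x)
        (_ : ∀ ω, RangeSAA.IsRangeRun X
          (fun i => gradient (RangeSAA.empiricalRisk f (fun j => z i j ω)))
          m α₁ α₂ γ (T + m - 1 + m₀) (fun t => W t ω) x₁ (fun t => x t ω)),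
        ∫ ω, ‖x (T + m + m₀) ω - xs‖ ^ 2 ∂Pr ≤
          (‖x₁ - xs‖ + γ * ((m : ℝ) + m₀ - 1)) ^ 2 *
              (1 - RangeSAA.contractionConst (L / μ) R pZ * γ) ^ T +
            C / (1 - pZ * (1 + L / μ)) *
              (1 / √(N * b) +
                RangeSAA.robustConst d α₂ *
                  (√(Real.log (2 * (1 - α₂) * N * d)) / √b +
                    Real.log (2 * (1 - α₂) * N * d) / b)) := by
  have hC₁ : 0 < 2 * σ + 64 * L * √d * R * d + 2 * a + 1 := by positivity
  set C₁ := 2 * σ + 64 * L * √d * R * d + 2 * a + 1 with hC₁def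
  rcases Nat.eq_zero_or_pos d with rfl | hd
  · refine ⟨1, one_pos, ?_⟩
    intro Z _ D _ f X xs _ _ _ _ _ _ hdiam
    rw [Metric.diam_subsingleton (Set.subsingleton_of_subsingleton)] at hdiam
    exact absurd hdiam hR.ne
  have hd1 : (1 : ℝ) ≤ d := by exact_mod_cast hd
  have hsd : 1 ≤ √(d : ℝ) := Real.one_le_sqrt.2 hd1
  have hl : 0 ≤ Real.log (2 * d) := Real.log_nonneg (by linarith)
  set ℓ := √(Real.log (2 * d)) + Real.log (2 * d) with hℓ
  have hℓ0 : 0 ≤ ℓ := by positivity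
  set κ := L / μ with hκ
  have hκ0 : 0 < κ := by positivity
  set A := 144 * √d * σ / μ + 4 * √d / μ * (C₁ * (2 * ℓ + 10)) with hA
  have hA0 : 0 < A := by positivity
  -- The fixed point of the recursion is `δ / q` with `δ ≤ A * (S + Q)` and `1 / q = κ * R / (2 *
  -- p)`.
  refine ⟨κ * R / 2 * A, by positivity, ?_⟩
  intro Z _ D _ f X xs _ hsc hnoise hf hconv hcpt hdiam hxs _ hgrad N b m m₀ T hN hb hm _ α₁ α₂ pb pt
    γ hpb hpbt hpt hα₁ hα₁k hα₂ hα₂k pZ hpZ hpZ1 hγ hstep hcontr Ω _ Pr _ ℱ z hz hD hind W hW x₁ hx₁ x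
    hx hrun
  have hXR : ∀ x ∈ X, ‖x - xs‖ ≤ R := fun y hy => by
    rw [← dist_eq_norm, ← hdiam]
    exact Metric.dist_le_diam_of_mem hcpt.isBounded hy hxs
  have hFlip : ∀ y ∈ X, ∀ w ∈ X, _ := fun y hy w hw =>
    RangeSAA.norm_gradient_expectedCost_sub_le hnoise ha hf hy hw
  have hμL : μ ≤ L := by
    have hX : X.Nontrivial := by
      by_contra hn
      rw [Set.not_nontrivial_iff] at hn
      rw [Metric.diam_subsingleton hn] at hdiam
      exact hR.ne hdiam
    exact hsc.le_of_lipschitz hX hFlip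
  have hα₁0 := RangeSAA.nonneg_of_mul_eq_natCast hm hα₁k
  have hα₂0 := RangeSAA.nonneg_of_mul_eq_natCast hN hα₂k
  have hpZ0 : 0 ≤ pZ :=
    (RangeSAA.failureProb_nonneg hpb.le (by linarith) (by linarith) hpt.le m₀ m N α₁ α₂).trans hpZ
  obtain ⟨H, Hb, hHi, hHbi, hH, hHb, hHe, hHbe⟩ := RangeSAA.exists_empirical_deviations hd hnoise hσ ha
    hL hf hxs hR hXR hN hb hz hD hind
  rw [← hC₁def] at hHe hHbe
  have hE : ∀ ω, 0 ≤ 2 * Hb ω + 10 * α₂ * H ω := by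
    intro ω
    have h1 := (abs_nonneg _).trans (hH ω ⟨0, hN⟩ xs hxs ⟨0, hd⟩)
    have h2 := (abs_nonneg _).trans (hHb ω xs hxs ⟨0, hd⟩)
    positivity
  -- the contraction constant
  have hp : 0 < 1 - pZ * (1 + κ) := by
    rw [lt_div_iff₀ (by positivity)] at hpZ1
    linarith
  set p := 1 - pZ * (1 + κ) with hpdef
  set q := RangeSAA.contractionConst κ R pZ with hq
  have hqp : q = 2 / (κ * R) * p := rfl
  have hq0 : 0 < q := by rw [hqp]; positivity
  have hm1 : (1 : ℝ) ≤ m := by exact_mod_cast hm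
  have hμLκ : μ / L = 1 / κ := by rw [hκ, one_div_div]
  have hκ1 : 1 / κ ≤ 1 := by rw [← hμLκ]; exact (div_le_one hL).2 hμL
  set EH := ∫ ω, H ω ∂Pr with hEH
  set EHb := ∫ ω, Hb ω ∂Pr with hEHb
  set δ := γ * (1 + 4 * pZ * (1 + 1 / κ) * ((m : ℝ) - 1 + m₀)) +
    2 * (1 + 1 / κ) * (√d * (2 * EHb + 10 * α₂ * EH + 18 * (L * (γ * (m - 1)))) / μ) with hδ
  have hxmeas : ∀ r, Measurable fun ω => ‖x r ω - xs‖ := fun r =>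
    (((hx r).mono (ℱ.le r) le_rfl).sub_const xs).norm
  have hmem : ∀ r, 1 ≤ r → r ≤ T + m - 1 + m₀ + 1 → ∀ ω, ‖x r ω - xs‖ ≤ R := fun r h1 h2 ω =>
    hXR _ ((hrun ω).mem hx₁ h1 h2)
  have hrec : ∀ k < T, ∫ ω, ‖x (m + m₀ + (k + 1)) ω - xs‖ ^ 2 ∂Pr ≤
      (1 - q * γ) * ∫ ω, ‖x (m + m₀ + k) ω - xs‖ ^ 2 ∂Pr + γ * δ := by
    intro k hk
    -- For `k = 0` the conditioning time is `1`, the first time of the chain; hence the recursion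
    -- starts at `m + m₀`, and only drift is used for the `m + m₀ - 1` steps before.
    have h1 := RangeSAA.integral_norm_sub_sq_le hW hx hrun hx₁ hconv hγ.le hxs hXR hN hm hμ hμL hα₁ hα₂
      hα₂0 hpZ hpZ0 hHi hHbi
      (fun ω i y hy w hw => RangeSAA.norm_gradient_empiricalRisk_sub_le hf hb _ hy hw) hH hHb
      (fun y hy => by have := hFlip y hy xs hxs; rwa [hgrad, sub_zero] at this)
      (fun y hy => by have := hsc.2 y hy xs hxs; rwa [hgrad, sub_zero] at this) hE
      (s := k + 1) (t := m + m₀ + k) (by omega) (by omega) (by omega)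
    -- Normalized steps give a decrease linear in the distance; the diameter converts it into one
    -- proportional to the squared distance.
    have hR2 : ∫ ω, ‖x (m + m₀ + k) ω - xs‖ ^ 2 ∂Pr ≤ R * ∫ ω, ‖x (m + m₀ + k) ω - xs‖ ∂Pr := by
      rw [← integral_const_mul]
      refine integral_mono_of_nonneg (Filter.Eventually.of_forall fun ω => by positivity) ?_
        (Filter.Eventually.of_forall fun ω => ?_)
      · refine ((integrable_const R).mono' (hxmeas _).aestronglyMeasurable
          (Filter.Eventually.of_forall fun ω => ?_)).const_mul R
        simpa using hmem (m + m₀ + k) (by omega) (by omega) ω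
      · have := hmem (m + m₀ + k) (by omega) (by omega) ω
        show ‖x (m + m₀ + k) ω - xs‖ ^ 2 ≤ R * ‖x (m + m₀ + k) ω - xs‖
        rw [sq]
        exact mul_le_mul_of_nonneg_right this (norm_nonneg _)
    rw [hμLκ] at h1
    have h2 : 2 * γ * (1 / κ - pZ * (1 + 1 / κ)) = q * γ * R := by
      rw [hqp, hpdef]; field_simp; ring
    rw [h2] at h1
    have h3 := mul_le_mul_of_nonneg_left hR2 (show 0 ≤ q * γ by positivity)
    have h4 : γ * δ = γ ^ 2 * (1 + 4 * pZ * (1 + 1 / κ) * ((m : ℝ) - 1 + m₀)) +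
      2 * γ * (1 + 1 / κ) * (√d * (2 * EHb + 10 * α₂ * EH + 18 * (L * (γ * (m - 1)))) / μ) := by
      rw [hδ]; ring
    rw [h4]
    change ∫ ω, ‖x (m + m₀ + k + 1) ω - xs‖ ^ 2 ∂Pr ≤ _
    linarith
  have hgeo := RangeSAA.le_geometric_of_step
    (a := fun k => ∫ ω, ‖x (m + m₀ + k) ω - xs‖ ^ 2 ∂Pr) (by positivity) hcontr hrec
  simp only [add_zero] at hgeo
  rw [show m + m₀ + T = T + m + m₀ by omega] at hgeo
  have hpow : 0 ≤ (1 - q * γ) ^ T := pow_nonneg (sub_nonneg.2 hcontr) T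
  -- the initial phase
  have hinit : ∫ ω, ‖x (m + m₀) ω - xs‖ ^ 2 ∂Pr ≤ (‖x₁ - xs‖ + γ * ((m : ℝ) + m₀ - 1)) ^ 2 := by
    have h1 : ∀ ω, ‖x (m + m₀) ω - xs‖ ≤ ‖x₁ - xs‖ + γ * ((m : ℝ) + m₀ - 1) := by
      intro ω
      have h2 := (hrun ω).norm_sub_le hx₁ hconv hγ.le le_rfl (m + m₀ - 1) (by omega)
      have h3 : x 1 ω = x₁ := (hrun ω).1
      rw [show 1 + (m + m₀ - 1) = m + m₀ by omega, Nat.cast_sub (by omega)] at h2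
      simp only [h3] at h2
      push_cast at h2
      calc _ = ‖(x (m + m₀) ω - x₁) + (x₁ - xs)‖ := by rw [sub_add_sub_cancel]
        _ ≤ _ := (norm_add_le _ _).trans (by linarith)
    have h3 : ∫ _ω, (‖x₁ - xs‖ + γ * ((m : ℝ) + m₀ - 1)) ^ 2 ∂Pr =
        (‖x₁ - xs‖ + γ * ((m : ℝ) + m₀ - 1)) ^ 2 := by simp
    rw [← h3]
    exact integral_mono_of_nonneg (Filter.Eventually.of_forall fun ω => by positivity)
      (integrable_const _)
      (Filter.Eventually.of_forall fun ω => pow_le_pow_left₀ (norm_nonneg _) (h1 ω) 2)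
  -- the error terms
  have hst := RangeSAA.step_terms_le hm hN hb hκ0 hμ hσ hpZ0 hγ.le hα₁0 hα₁ hα₂0 hα₂ hstep
  have hdev := RangeSAA.mul_deviation_le (b := b) hd hN hα₂ hα₂k
  set S := 1 / √(N * b : ℝ) with hS
  have hS0 : 0 ≤ S := by positivity
  set Q := RangeSAA.robustConst d α₂ * (√(Real.log (2 * (1 - α₂) * N * d)) / √b +
    Real.log (2 * (1 - α₂) * N * d) / b) with hQ
  have hQ0 : 0 ≤ Q := by
    have := RangeSAA.log_trimmed_nonneg hd hN hα₂
    have := RangeSAA.robustConst_nonneg d hα₂0 hα₂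
    positivity
  have hαH : 10 * α₂ * EH ≤ 10 * C₁ * Q := by
    have h1 := mul_le_mul_of_nonneg_left hHe (show 0 ≤ 10 * α₂ by positivity)
    have h2 := mul_le_mul_of_nonneg_left hdev (show 0 ≤ 5 * C₁ by positivity)
    rw [hQ]
    linarith
  have hEsum : 2 * EHb + 10 * α₂ * EH ≤ C₁ * (2 * ℓ + 10) * (S + Q) := by
    have e1 : 0 ≤ C₁ * ℓ * Q := by positivity
    have e2 : 0 ≤ C₁ * S := by positivity
    have e3 : C₁ * (2 * ℓ + 10) * (S + Q) =
        2 * (C₁ * (ℓ * S)) + 10 * C₁ * Q + 2 * (C₁ * ℓ * Q) + 10 * (C₁ * S) := by ring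
    rw [e3]
    linarith only [e1, e2, hHbe, hαH]
  have hδA : δ ≤ A * (S + Q) := by
    have e0 : 0 ≤ 2 * EHb + 10 * α₂ * EH := by
      have i1 : 0 ≤ EHb := integral_nonneg fun ω => (abs_nonneg _).trans (hHb ω xs hxs ⟨0, hd⟩)
      have i2 : 0 ≤ EH := integral_nonneg fun ω =>
        (abs_nonneg _).trans (hH ω ⟨0, hN⟩ xs hxs ⟨0, hd⟩)
      positivity
    exact RangeSAA.error_terms_le hsd hκ hμ hL hσ hγ.le hpZ0 hκ1 (by linarith)
      (by have : (0 : ℝ) ≤ m₀ := Nat.cast_nonneg _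
          linarith) hQ0 hst e0 hEsum
  have hδ0 : 0 ≤ A * (S + Q) := by positivity
  have hfin : γ * δ / (q * γ) * (1 - (1 - q * γ) ^ T) ≤ κ * R / 2 * A / p * (S + Q) := by
    have e1 : γ * δ / (q * γ) = δ / q := by field_simp
    rw [e1]
    calc δ / q * (1 - (1 - q * γ) ^ T) ≤ A * (S + Q) / q * 1 := by
          have h1 : (1 - q * γ) ^ T ≤ 1 := pow_le_one₀ (sub_nonneg.2 hcontr) (by
            have : 0 ≤ q * γ := by positivity
            linarith)
          refine mul_le_mul (by gcongr) (by linarith) (by linarith) (by positivity)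
      _ = _ := by rw [hqp]; field_simp
  have := mul_le_mul_of_nonneg_right hinit hpow
  linarith
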